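/- Consider turnstile streams over $[n]$: an update is a pair $(a,\Delta)\in X=[n]\times\{\pm1\}$, a stream $\vec u$ has the frequency vector $f_a(\vec u)=\sum_{(a,\Delta)\in \vec u}\Delta$, and $F_2(\vec u)=\sum_{a\in[n]} f_a(\vec u)^2$. In the ASA game (adversarial streaming with advice) with query/advice rate $\eta\ge 1$, stream length $m$ and at most $T$ queries, a randomized streaming algorithm plays against an adaptive, possibly randomized and computationally unbounded adversary. In each round $i=1,\dots,m$: (1) the adversary, who knows all previous updates and responses, chooses an update $x_i\in X$ and a query demand $q_i\in\{0,1\}$, subject to $\sum_{j\le i}q_j\le T$; (2) the algorithm processes $x_i$; (3) if $q_i=1$, the algorithm outputs a response $z_i\in\mathbb R$, which is given to the adversary, and if moreover $\sum_{j\le i}q_j\equiv 0 \pmod \eta$, the algorithm specifies a predicate $p_i:X^*\to\{0,1\}$ and obtains the bit $p_i(x_1,\dots,x_i)$. The algorithm uses space $S$ if everything it carries from one step to the next, stored random strings included, is kept in $S$ bits of memory; it may toss fresh coins in each step. Theorem ($F_2$ estimation in the ASA model). There are universal constants $C>0$ and $c\in\mathbb N$ such that for all integers $\eta\ge1$ and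 $n,m\ge 0$ and all real $\alpha,\beta>0$ there is a streaming algorithm for the ASA game with query/advice rate $\eta$ and stream length $m$ that uses space $$S\;\le\; C\cdot\frac{\eta}{\alpha^4}\cdot\log^{c}\Bigl(2+\frac{nm}{\alpha\beta}\Bigr)\;=\;\tilde O\Bigl(\frac{\eta}{\alpha^4}\Bigr)$$ and such that, for every $T$ and every adversary making at most $T$ queries, with probability at least $1-\beta$ every response satisfies $|z_i-F_2(x_1,\dots,x_i)|\le\alpha\,F_2(x_1,\dots,x_i)$. -/

import Mathlib

noncomputable section

namespace ASA

/-- A randomized streaming algorithm over the update domain `X`, with `S` bits of memory, for the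
adversarial streaming game with advice. Everything that is carried from one step to the next,
random strings included, has to be kept in the `S` bits; each step may toss fresh coins. -/
structure Algorithm (X : Type) (S : ℕ) where
  /-- the distribution of the initial memory content -/
  init : PMF (Fin S → Bool)
  /-- processing of an update -/
  update : (Fin S → Bool) → X → PMF (Fin S → Bool)
  /-- answering a query: the new memory content and the response -/
  respond : (Fin S → Bool) → PMF ((Fin S → Bool) × ℝ)
  /-- the predicate specified when a bit of advice is granted -/
  predicate : (Fin S → Bool) → List X → Bool
  /-- processing of the bit of advice -/
  receive : (Fin S → Bool) → Bool → PMF (Fin S → Bool)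

/-- What the adversary has seen so far, oldest round first: for every round the update, together
with the response if there was a query in that round (`none` if there was no query). -/
abbrev History (X : Type) : Type := List (X × Option ℝ)

/-- The stream of the updates so far. -/
def History.stream {X : Type} (h : History X) : List X := h.map Prod.fst

/-- The number of queries made so far. -/
def History.queries {X : Type} (h : History X) : ℕ := h.countP fun r => r.2.isSome

/-- A randomized, adaptive, computationally unbounded adversary: given the history it chooses the
next update and the next query demand. -/
abbrev Adversary (X : Type) : Type := History X → PMF (X × Bool)

/-- The adversary makes at most `T` queries: after `T` queries it never demands another one. -/
def Adversary.WithinBudget {X : Type} (adv : Adversary X) (T : ℕ) : Prop :=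
  ∀ h : History X, T ≤ h.queries → ∀ move ∈ (adv h).support, move.2 = false

/-- One round of the game with query/advice rate `η`, from a memory content and a history to the
next memory content and the next history. -/
def playRound {X : Type} {S : ℕ} (η : ℕ) (alg : Algorithm X S) (adv : Adversary X)
    (c : (Fin S → Bool) × History X) : PMF ((Fin S → Bool) × History X) :=
  (adv c.2).bind fun move =>
  (alg.update c.1 move.1).bind fun s₁ =>
  if move.2 = true then
    (alg.respond s₁).bind fun answer =>
    let h : History X := c.2 ++ [(move.1, some answer.2)]
    if h.queries % η = 0 then
      (alg.receive answer.1 (alg.predicate answer.1 h.stream)).bind fun s₂ => PMF.pure (s₂, h)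
    else PMF.pure (answer.1, h)
  else PMF.pure (s₁, c.2 ++ [(move.1, none)])

/-- The joint distribution of the memory content and the history after `m` rounds. -/
def play {X : Type} {S : ℕ} (η : ℕ) (alg : Algorithm X S) (adv : Adversary X) :
    ℕ → PMF ((Fin S → Bool) × History X)
  | 0 => alg.init.bind fun s => PMF.pure (s, [])
  | m + 1 => (play η alg adv m).bind (playRound η alg adv)

/-- Every response is in `(1 ± α) · g` of the stream up to and including its round. -/
def History.Accurate {X : Type} (g : List X → ℝ) (α : ℝ) (h : History X) : Prop :=
  ∀ (i : ℕ) (x : X) (z : ℝ), h[i]? = some (x, some z) →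
    |z - g (History.stream (h.take (i + 1)))| ≤ α * |g (History.stream (h.take (i + 1)))|

/-- In the game with query/advice rate `η`, stream length `m` and at most `T` queries, against
every adversary, all responses are `α`-accurate for `g` except with probability at most `β`. -/
def Algorithm.IsRobust {X : Type} {S : ℕ} (alg : Algorithm X S) (g : List X → ℝ)
    (η m T : ℕ) (α β : ℝ) : Prop :=
  ∀ adv : Adversary X, adv.WithinBudget T →
    ENNReal.ofReal (1 - β) ≤
      (play η alg adv m).toOuterMeasure {c | History.Accurate g α c.2}

/-- An update `(a, Δ)` of a turnstile stream over `n` elements, `Δ = ± 1`. -/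
abbrev Update (n : ℕ) : Type := Fin n × ℤˣ

/-- The frequency of `a`: the sum of the increments `Δ` of the updates to `a`. -/
def freq {n : ℕ} (u : List (Update n)) (a : Fin n) : ℤ :=
  (u.map fun p => if p.1 = a then (p.2 : ℤ) else 0).sum

/-- The second frequency moment. -/
def F₂ {n : ℕ} (u : List (Update n)) : ℝ := ∑ a : Fin n, (freq u a : ℝ) ^ 2

end ASA

end

/-!
Every response is drawn by a vote of `r` independently seeded linear sketches, a candidate with `v`
votes being chosen with probability proportional to `(1 + θ) ^ v`. If all sketches vote for the true
value and for accurate values only, an inaccurate response is exponentially unlikely. On the other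
hand, ignoring the votes of one sketch changes the distribution of a response by a chi-squared
divergence of at most `θ ^ 2`. Over `N ≤ θ⁻¹ ^ 2` queries the history therefore remains almost
independent of each single seed: an event that has probability `p` for a fixed stream has
probability at most `2 √p` for the adaptively chosen one.

The number of queries to one generation of sketches is kept bounded by means of the advice. A
generation with fresh seeds starts to process updates at the moment when its seeds are drawn. As
the sketches are linear, all it is missing is the contribution of the earlier updates, which is
fixed at that moment. If a sketch has counters of `b` bits, then `r b` bits of advice, obtained in
`η r b` queries, reveal this contribution, and the new generation replaces the old one. It remains
to have `η r b ≤ θ⁻¹ ^ 2` with `r` of the order of `θ⁻¹` up to logarithmic factors, so `θ⁻¹` and `r`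
are chosen of the order of `η b`, and the memory is of the order of `r b`, that is, of `η b ^ 2`.

For the second moment, a sketch consists of inner products of the frequency vector with fourwise
uncorrelated sign vectors. Averages of the squares of about `α⁻¹ ^ 2` of them and a majority vote
over logarithmically many averages identify the accurate candidates, so `b` is of the order of
`α⁻¹ ^ 2`.
-/

open scoped ENNReal NNReal Matrix

noncomputable section

namespace ASA

/-! ### Expectations -/

/-- The expectation of a nonnegative function under a discrete distribution, a sum rather than an
integral so that no `MeasurableSpace` has to be chosen. -/
def expect {α : Type*} (p : PMF α) (f : α → ℝ≥0∞) : ℝ≥0∞ := ∑' a, p a * f a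

section expect

variable {α β : Type*}

lemma expect_pure (a : α) (f : α → ℝ≥0∞) : expect (PMF.pure a) f = f a := by
  rw [expect, tsum_eq_single a fun b hb => by simp [PMF.pure_apply, hb]]
  simp

lemma expect_bind (p : PMF α) (k : α → PMF β) (f : β → ℝ≥0∞) :
    expect (p.bind k) f = expect p fun a => expect (k a) f := by
  simp only [expect, PMF.bind_apply, ← ENNReal.tsum_mul_right, ← ENNReal.tsum_mul_left, mul_assoc]
  exact ENNReal.tsum_comm

lemma expect_map (p : PMF α) (g : α → β) (f : β → ℝ≥0∞) :
    expect (p.map g) f = expect p fun a => f (g a) := by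
  simp only [PMF.map, expect_bind, Function.comp_apply, expect_pure]

lemma expect_mono_support {p : PMF α} {f g : α → ℝ≥0∞} (h : ∀ a ∈ p.support, f a ≤ g a) :
    expect p f ≤ expect p g := by
  refine ENNReal.tsum_le_tsum fun a => ?_
  by_cases ha : p a = 0
  · simp [ha]
  · exact mul_le_mul_right (h a ((p.mem_support_iff a).2 ha)) _

lemma expect_mono {p : PMF α} {f g : α → ℝ≥0∞} (h : ∀ a, f a ≤ g a) :
    expect p f ≤ expect p g :=
  expect_mono_support fun a _ => h a

lemma expect_congr {p : PMF α} {f g : α → ℝ≥0∞} (h : ∀ a ∈ p.support, f a = g a) :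
    expect p f = expect p g :=
  (expect_mono_support fun a ha => (h a ha).le).antisymm
    (expect_mono_support fun a ha => (h a ha).ge)

lemma expect_const (p : PMF α) (c : ℝ≥0∞) : expect p (fun _ => c) = c := by
  rw [expect, ENNReal.tsum_mul_right, p.tsum_coe, one_mul]

lemma expect_le_of_forall_le {p : PMF α} {f : α → ℝ≥0∞} {c : ℝ≥0∞} (h : ∀ a ∈ p.support, f a ≤ c) :
    expect p f ≤ c :=
  (expect_mono_support h).trans (expect_const p c).le

lemma expect_add (p : PMF α) (f g : α → ℝ≥0∞) :
    expect p (fun a => f a + g a) = expect p f + expect p g := by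
  simp only [expect, mul_add, ENNReal.tsum_add]

lemma expect_sum {ι : Type*} (p : PMF α) (s : Finset ι) (f : ι → α → ℝ≥0∞) :
    expect p (fun a => ∑ i ∈ s, f i a) = ∑ i ∈ s, expect p (f i) := by
  simp only [expect, Finset.mul_sum]
  exact Summable.tsum_finsetSum fun _ _ => ENNReal.summable

lemma expect_const_mul (p : PMF α) (c : ℝ≥0∞) (f : α → ℝ≥0∞) :
    expect p (fun a => c * f a) = c * expect p f := by
  simp only [expect, ← ENNReal.tsum_mul_left, mul_left_comm]

lemma expect_comm (p : PMF α) (q : PMF β) (f : α → β → ℝ≥0∞) :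
    expect p (fun a => expect q (f a)) = expect q fun b => expect p fun a => f a b := by
  simp only [expect, ← ENNReal.tsum_mul_left, mul_left_comm]
  exact ENNReal.tsum_comm

lemma expect_indicator_one (p : PMF α) (s : Set α) :
    expect p (s.indicator 1) = p.toOuterMeasure s := by
  rw [PMF.toOuterMeasure_apply]
  refine tsum_congr fun a => ?_
  by_cases h : a ∈ s <;> simp [h]

lemma expect_eq_lintegral [MeasurableSpace α] [DiscreteMeasurableSpace α] (p : PMF α)
    (f : α → ℝ≥0∞) :
    expect p f = ∫⁻ a, f a ∂MeasureTheory.Measure.sum fun a => p a • .dirac a := by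
  simp [expect, MeasureTheory.lintegral_sum_measure, MeasureTheory.lintegral_smul_measure]

lemma sq_expect_mul_le (p : PMF α) (f g : α → ℝ≥0∞) :
    expect p (fun a => f a * g a) ^ 2 ≤
      expect p (fun a => f a ^ 2) * expect p fun a => g a ^ 2 := by
  let _ : MeasurableSpace α := ⊤
  have sq_rpow_half (x : ℝ≥0∞) : (x ^ (1 / 2 : ℝ)) ^ 2 = x := by
    rw [← ENNReal.rpow_natCast, ← ENNReal.rpow_mul]
    norm_num
  have holder := ENNReal.lintegral_mul_le_Lp_mul_Lq
    (MeasureTheory.Measure.sum fun a => p a • MeasureTheory.Measure.dirac a) .two_two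
    (f := f) (g := g) measurable_from_top.aemeasurable measurable_from_top.aemeasurable
  simp only [ENNReal.rpow_two, ← expect_eq_lintegral, Pi.mul_apply] at holder
  calc expect p (fun a => f a * g a) ^ 2
      ≤ (expect p (fun a => f a ^ 2) ^ (1 / 2 : ℝ) *
          expect p (fun a => g a ^ 2) ^ (1 / 2 : ℝ)) ^ 2 := pow_le_pow_left' holder 2
    _ = _ := by rw [mul_pow, sq_rpow_half, sq_rpow_half]

lemma sq_expect_le (p : PMF α) (f : α → ℝ≥0∞) :
    expect p f ^ 2 ≤ expect p fun a => f a ^ 2 := by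
  simpa [expect_const] using sq_expect_mul_le p f fun _ => 1

lemma expect_sq_one_add_indicator_le (p : PMF α) (θ : ℝ≥0) (s : Set α) :
    expect p (fun a => (1 + θ * s.indicator 1 a) ^ 2) ≤
      (1 + θ ^ 2) * expect p (fun a => 1 + θ * s.indicator 1 a) ^ 2 := by
  have mass_le_one : p.toOuterMeasure s ≤ 1 := by
    rw [← expect_indicator_one]
    exact expect_le_of_forall_le fun a _ => Set.indicator_le_self' (by simp) a
  have first_moment : expect p (fun a => 1 + θ * s.indicator 1 a) =
      1 + θ * p.toOuterMeasure s := by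
    rw [expect_add, expect_const, expect_const_mul, expect_indicator_one]
  have second_moment : expect p (fun a => (1 + θ * s.indicator 1 a) ^ 2) =
      1 + (2 * θ + θ ^ 2) * p.toOuterMeasure s := by
    rw [← expect_indicator_one, ← expect_const_mul, ← expect_const p 1, ← expect_add, expect_const]
    refine expect_congr fun a _ => ?_
    by_cases ha : a ∈ s <;> simp [ha]
    ring
  rw [first_moment, second_moment]
  generalize p.toOuterMeasure s = μ at mass_le_one
  lift μ to ℝ≥0 using ne_top_of_le_ne_top ENNReal.one_ne_top mass_le_one
  have μ_le_one : μ ≤ 1 := mod_cast mass_le_one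
  norm_cast
  calc 1 + (2 * θ + θ ^ 2) * μ = 1 + 2 * θ * μ + θ ^ 2 * μ := by ring
    _ ≤ 1 + 2 * θ * μ + θ ^ 2 * 1 := by gcongr
    _ ≤ 1 + 2 * θ * μ + θ ^ 2 * 1 + (θ ^ 2 * μ ^ 2 + θ ^ 2 * (2 * θ * μ + θ ^ 2 * μ ^ 2)) :=
        le_self_add
    _ = (1 + θ ^ 2) * (1 + θ * μ) ^ 2 := by ring

lemma expect_uniformOfFintype [Fintype α] [Nonempty α] (f : α → ℝ≥0∞) :
    expect (PMF.uniformOfFintype α) f = (Fintype.card α : ℝ≥0∞)⁻¹ * ∑ a, f a := by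
  simp [expect, tsum_fintype, Finset.mul_sum]

lemma sum_sum_update {ι M : Type*} [Fintype ι] [DecidableEq ι] [Fintype α] [AddCommMonoid M]
    (j : ι) (f : (ι → α) → M) :
    ∑ A : ι → α, ∑ a : α, f (Function.update A j a) = Fintype.card α • ∑ A : ι → α, f A := by
  have swap_involutive : Function.Involutive
      fun p : (ι → α) × α => (Function.update p.1 j p.2, p.1 j) := fun p => by simp
  calc ∑ A : ι → α, ∑ a : α, f (Function.update A j a)
      = ∑ p : (ι → α) × α, f (Function.update p.1 j p.2) := by rw [Fintype.sum_prod_type]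
    _ = ∑ p : (ι → α) × α, f p.1 :=
        Fintype.sum_equiv swap_involutive.toPerm _ _ fun _ => rfl
    _ = Fintype.card α • ∑ A : ι → α, f A := by
        simp [Fintype.sum_prod_type, Finset.smul_sum]

lemma expect_uniform_update {ι : Type*} [Fintype ι] [DecidableEq ι] [Fintype α] [Nonempty α]
    (j : ι) (f : (ι → α) → ℝ≥0∞) :
    expect (PMF.uniformOfFintype (ι → α))
        (fun A => expect (PMF.uniformOfFintype α) fun a => f (Function.update A j a)) =
      expect (PMF.uniformOfFintype (ι → α)) f := by
  simp only [expect_uniformOfFintype]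
  rw [← Finset.mul_sum, sum_sum_update, nsmul_eq_mul, ← mul_assoc ((Fintype.card α : ℝ≥0∞)⁻¹),
    ENNReal.inv_mul_cancel (by simp) (by simp), one_mul]

end expect

/-! ### Selection by exponential weights -/

section select

variable {ι Z : Type*}

open Classical in
/-- The weight `(1 + θ) ^ v` of a candidate with `v` votes; `V i` is the set of the candidates
that the voter `i` votes for, and `J` is the set of the voters. -/
def voteWeight (θ : ℝ≥0) (J : Finset ι) (V : ι → Set Z) (z : Z) : ℝ≥0∞ :=
  (1 + θ) ^ {i ∈ J | z ∈ V i}.card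

lemma voteWeight_ne_zero (θ : ℝ≥0) (J : Finset ι) (V : ι → Set Z) (z : Z) :
    voteWeight θ J V z ≠ 0 := by
  simp [voteWeight]

lemma voteWeight_ne_top (θ : ℝ≥0) (J : Finset ι) (V : ι → Set Z) (z : Z) :
    voteWeight θ J V z ≠ ⊤ := by
  simp [voteWeight]

lemma voteWeight_eq_erase_mul [DecidableEq ι] (θ : ℝ≥0) {J : Finset ι} {j : ι} (hj : j ∈ J)
    (V : ι → Set Z) (z : Z) :
    voteWeight θ J V z = voteWeight θ (J.erase j) V z * (1 + θ * (V j).indicator 1 z) := by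
  classical
  unfold voteWeight
  nth_rw 1 [← Finset.insert_erase hj]
  by_cases hz : z ∈ V j
  · simp [Finset.filter_insert, hz, pow_succ]
  · simp [Finset.filter_insert, hz]

variable [Fintype Z]

lemma sum_voteWeight_ne_top (θ : ℝ≥0) (J : Finset ι) (V : ι → Set Z) :
    ∑ z, voteWeight θ J V z ≠ ⊤ :=
  ENNReal.sum_ne_top.2 fun z _ => voteWeight_ne_top θ J V z

variable [Nonempty Z]

lemma sum_voteWeight_ne_zero (θ : ℝ≥0) (J : Finset ι) (V : ι → Set Z) :
    ∑ z, voteWeight θ J V z ≠ 0 := by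
  simp [Finset.sum_eq_zero_iff, voteWeight_ne_zero]

/-- The exponential-weights selection of a candidate: the candidate `z` is drawn with probability
proportional to `voteWeight θ J V z`. -/
def select (θ : ℝ≥0) (J : Finset ι) (V : ι → Set Z) : PMF Z :=
  PMF.normalize (voteWeight θ J V)
    (by simpa only [tsum_fintype] using sum_voteWeight_ne_zero θ J V)
    (by simpa only [tsum_fintype] using sum_voteWeight_ne_top θ J V)

lemma expect_select (θ : ℝ≥0) (J : Finset ι) (V : ι → Set Z) (f : Z → ℝ≥0∞) :
    expect (select θ J V) f =
      (∑ z, voteWeight θ J V z * f z) * (∑ z, voteWeight θ J V z)⁻¹ := by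
  simp only [expect, select, PMF.normalize_apply, tsum_fintype, Finset.sum_mul, mul_right_comm]

lemma select_congr (θ : ℝ≥0) {J : Finset ι} {V V' : ι → Set Z} (h : ∀ i ∈ J, V i = V' i) :
    select θ J V = select θ J V' := by
  classical
  have weights_eq : voteWeight θ J V = voteWeight θ J V' := by
    funext z
    unfold voteWeight
    congr 2
    exact Finset.filter_congr fun i hi => by rw [h i hi]
  simp only [select, weights_eq]

lemma expect_select_indicator_le (θ : ℝ≥0) {J : Finset ι} {V : ι → Set Z} {z₀ : Z}
    (hz₀ : ∀ i ∈ J, z₀ ∈ V i) {B : Set Z} (hB : ∀ z ∈ B, ∀ i ∈ J, z ∉ V i) :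
    expect (select θ J V) (B.indicator 1) ≤
      Fintype.card Z * ((1 + θ : ℝ≥0∞) ^ J.card)⁻¹ := by
  classical
  have weight_of_mem (z : Z) : voteWeight θ J V z * B.indicator 1 z ≤ 1 := by
    by_cases hz : z ∈ B
    · simp [voteWeight, Finset.filter_false_of_mem (hB z hz), hz]
    · simp [hz]
  have weight_winner : voteWeight θ J V z₀ = (1 + θ) ^ J.card := by
    rw [voteWeight, Finset.filter_true_of_mem hz₀]
  rw [expect_select]
  refine mul_le_mul' ?_ (ENNReal.inv_le_inv.2 ?_)
  · simpa using Finset.sum_le_sum fun z (_ : z ∈ Finset.univ) => weight_of_mem z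
  · rw [← weight_winner]
    exact Finset.single_le_sum (fun _ _ => zero_le) (Finset.mem_univ z₀)

lemma expect_select_mul_expect_select_erase [DecidableEq ι] (θ : ℝ≥0) {J : Finset ι} {j : ι}
    (hj : j ∈ J) (V : ι → Set Z) (f : Z → ℝ≥0∞) :
    expect (select θ J V) f *
        expect (select θ (J.erase j) V) (fun z => 1 + θ * (V j).indicator 1 z) =
      expect (select θ (J.erase j) V) fun z => (1 + θ * (V j).indicator 1 z) * f z := by
  have sum_mul_inv := ENNReal.mul_inv_cancel (sum_voteWeight_ne_zero θ J V)
    (sum_voteWeight_ne_top θ J V)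
  simp only [expect_select, ← mul_assoc, ← voteWeight_eq_erase_mul θ hj]
  rw [mul_assoc (∑ z, _), mul_comm _ (∑ z, voteWeight θ J V z), sum_mul_inv, mul_one]

/-- Dismissing one voter changes the distribution of the winner only by a chi-squared divergence
of `θ ^ 2`, hence quadratically little in `θ`. -/
lemma sq_expect_select_le [DecidableEq ι] (θ : ℝ≥0) {J : Finset ι} {j : ι} (hj : j ∈ J)
    (V : ι → Set Z) (f : Z → ℝ≥0∞) :
    expect (select θ J V) f ^ 2 ≤
      (1 + θ ^ 2) * expect (select θ (J.erase j) V) fun z => f z ^ 2 := by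
  set p := select θ (J.erase j) V
  set g : Z → ℝ≥0∞ := fun z => 1 + θ * (V j).indicator 1 z
  have g_le (z : Z) : g z ≤ 1 + θ := by
    by_cases hz : z ∈ V j <;> simp [g, hz]
  have expect_g_ne_zero : expect p g ≠ 0 := by
    refine (zero_lt_one.trans_le ?_).ne'
    exact (expect_const p 1).ge.trans (expect_mono fun z => le_self_add)
  have expect_g_ne_top : expect p g ≠ ⊤ :=
    ne_top_of_le_ne_top (by simp) (expect_le_of_forall_le fun z _ => g_le z)
  refine (ENNReal.mul_le_mul_iff_left (pow_ne_zero 2 expect_g_ne_zero)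
    (ENNReal.pow_ne_top expect_g_ne_top)).1 ?_
  calc expect (select θ J V) f ^ 2 * expect p g ^ 2
      = expect p (fun z => g z * f z) ^ 2 := by
        rw [← mul_pow, expect_select_mul_expect_select_erase θ hj]
    _ ≤ expect p (fun z => g z ^ 2) * expect p (fun z => f z ^ 2) := sq_expect_mul_le p g f
    _ ≤ (1 + θ ^ 2) * expect p g ^ 2 * expect p (fun z => f z ^ 2) := by
        gcongr
        exact expect_sq_one_add_indicator_le p θ (V j)
    _ = (1 + θ ^ 2) * expect p (fun z => f z ^ 2) * expect p g ^ 2 := by ring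

end select

/-! ### Histories -/

section History

variable {X : Type}

namespace History

lemma queries_append_none (h : History X) (x : X) :
    queries (h ++ [(x, none)]) = h.queries := by
  simp [queries]

lemma queries_append_some (h : History X) (x : X) (z : ℝ) :
    queries (h ++ [(x, some z)]) = h.queries + 1 := by
  simp [queries]

lemma stream_append (h : History X) (r : X × Option ℝ) :
    stream (h ++ [r]) = h.stream ++ [r.1] := by
  simp [stream]

lemma length_stream (h : History X) : h.stream.length = h.length := by
  simp [stream]

lemma queries_le_length (h : History X) : h.queries ≤ h.length := List.countP_le_length

lemma accurate_nil (g : List X → ℝ) (α : ℝ) : Accurate g α [] := by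
  simp [Accurate]

lemma accurate_append_iff {g : List X → ℝ} {α : ℝ} {h : History X} {r : X × Option ℝ} :
    Accurate g α (h ++ [r]) ↔ h.Accurate g α ∧
      ∀ z, r.2 = some z → |z - g (h.stream ++ [r.1])| ≤ α * |g (h.stream ++ [r.1])| := by
  constructor
  · refine fun hacc => ⟨fun i x z hi => ?_, fun z hz => ?_⟩
    · have hlt : i < h.length := (List.getElem?_eq_some_iff.1 hi).1
      have := hacc i x z (by rwa [List.getElem?_append_left hlt])
      rwa [List.take_append_of_le_length hlt] at this
    · have := hacc h.length r.1 z (by simp [← hz])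
      rwa [List.take_of_length_le (by simp), stream_append] at this
  · rintro ⟨hacc, hr⟩ i x z hi
    have hle : i ≤ h.length := by
      have := (List.getElem?_eq_some_iff.1 hi).1
      rw [List.length_append, List.length_singleton] at this
      omega
    rcases hle.lt_or_eq with hlt | rfl
    · rw [List.getElem?_append_left hlt] at hi
      rw [List.take_append_of_le_length hlt]
      exact hacc i x z hi
    · obtain rfl : r = (x, some z) := by simpa using hi
      rw [List.take_of_length_le (by simp), stream_append]
      exact hr z rfl

lemma accurate_append_none_iff {g : List X → ℝ} {α : ℝ} {h : History X} {x : X} :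
    Accurate g α (h ++ [(x, none)]) ↔ h.Accurate g α := by
  simp [accurate_append_iff]

lemma accurate_append_some_iff {g : List X → ℝ} {α : ℝ} {h : History X} {x : X} {z : ℝ} :
    Accurate g α (h ++ [(x, some z)]) ↔
      h.Accurate g α ∧ |z - g (h.stream ++ [x])| ≤ α * |g (h.stream ++ [x])| := by
  simp [accurate_append_iff]

end History

end History

/-! ### The seed game -/

section SeedGame

variable {X : Type} {ι K : Type*} [Fintype ι] [DecidableEq ι] [Fintype K] [Nonempty K]

/-- The seeds of the sketches after `k` queries: all of them are drawn anew when `L ∣ k`. -/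
def renewSeeds (L k : ℕ) (A : ι → K) : PMF (ι → K) :=
  if L ∣ k then PMF.uniformOfFintype (ι → K) else PMF.pure A

/-- One round of the seed game, an idealization of the streaming game in which the algorithm knows
the whole stream, responds according to `ρ`, and has no other memory than the seeds of its
sketches. -/
def seedRound (L : ℕ) (ρ : (ι → K) → History X → X → PMF ℝ) (adv : Adversary X)
    (c : (ι → K) × History X) : PMF ((ι → K) × History X) :=
  (adv c.2).bind fun move =>
  if move.2 = true then
    (ρ c.1 c.2 move.1).bind fun z =>
    (renewSeeds L (c.2.queries + 1) c.1).map fun A => (A, c.2 ++ [(move.1, some z)])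
  else PMF.pure (c.1, c.2 ++ [(move.1, none)])

/-- The joint distribution of the seeds and the history after a number of rounds of the seed
game. -/
def seedPlay (L : ℕ) (ρ : (ι → K) → History X → X → PMF ℝ) (adv : Adversary X) :
    ℕ → PMF ((ι → K) × History X)
  | 0 => (PMF.uniformOfFintype (ι → K)).map fun A => (A, [])
  | i + 1 => (seedPlay L ρ adv i).bind (seedRound L ρ adv)

variable (L : ℕ) (ρ ρ' : (ι → K) → History X → X → PMF ℝ) (adv : Adversary X)

lemma expect_seedRound (c : (ι → K) × History X) (f : (ι → K) × History X → ℝ≥0∞) :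
    expect (seedRound L ρ adv c) f = expect (adv c.2) fun move =>
      if move.2 = true then
        expect (ρ c.1 c.2 move.1) fun z =>
          expect (renewSeeds L (c.2.queries + 1) c.1) fun A => f (A, c.2 ++ [(move.1, some z)])
      else f (c.1, c.2 ++ [(move.1, none)]) := by
  rw [seedRound, expect_bind]
  refine expect_congr fun move _ => ?_
  split_ifs
  · simp only [expect_bind, expect_map]
  · rw [expect_pure]

lemma expect_seedRound_history (c : (ι → K) × History X) (f : History X → ℝ≥0∞) :
    expect (seedRound L ρ adv c) (fun c => f c.2) = expect (adv c.2) fun move =>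
      if move.2 = true then
        expect (ρ c.1 c.2 move.1) fun z => f (c.2 ++ [(move.1, some z)])
      else f (c.2 ++ [(move.1, none)]) := by
  simp only [expect_seedRound, expect_const]

lemma length_of_mem_support_seedPlay {L : ℕ} {ρ : (ι → K) → History X → X → PMF ℝ}
    {adv : Adversary X} {i : ℕ} {c : (ι → K) × History X}
    (hc : c ∈ (seedPlay L ρ adv i).support) : c.2.length = i := by
  induction i generalizing c with
  | zero =>
    simp only [seedPlay, PMF.mem_support_map_iff] at hc
    obtain ⟨A, -, rfl⟩ := hc
    rfl
  | succ i ih =>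
    simp only [seedPlay, seedRound, PMF.mem_support_bind_iff] at hc
    obtain ⟨c', hc', move, -, hc⟩ := hc
    split_ifs at hc
    · simp only [PMF.mem_support_bind_iff, PMF.mem_support_map_iff] at hc
      obtain ⟨z, -, A, -, rfl⟩ := hc
      simp [ih hc']
    · obtain rfl := (PMF.mem_support_pure_iff _ _).1 hc
      simp [ih hc']

lemma mul_sq_expect_seedRound_le {W : History X → ℝ≥0∞}
    (hnone : ∀ h x, W h ≤ W (h ++ [(x, none)]))
    (hsome : ∀ A h x (f : ℝ → ℝ≥0∞), W h * expect (ρ A h x) f ^ 2 ≤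
      expect (ρ' A h x) fun z => W (h ++ [(x, some z)]) * f z ^ 2)
    (c : (ι → K) × History X) (f : (ι → K) × History X → ℝ≥0∞) :
    W c.2 * expect (seedRound L ρ adv c) f ^ 2 ≤
      expect (seedRound L ρ' adv c) fun c => W c.2 * f c ^ 2 := by
  simp only [expect_seedRound]
  refine (mul_le_mul_right (sq_expect_le _ _) _).trans ?_
  rw [← expect_const_mul]
  refine expect_mono fun move => ?_
  split_ifs
  · refine (hsome _ _ _ _).trans (expect_mono fun z => ?_)
    rw [expect_const_mul]
    exact mul_le_mul_right (sq_expect_le _ _) _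
  · exact mul_le_mul_left (hnone _ _) _

/-- Comparison of two seed games whose response distributions are close in the sense of the
chi-squared divergence; the weight `W` of a history accounts for the divergence so far. -/
lemma sq_expect_seedPlay_le {W : History X → ℝ≥0∞} (hnil : 1 ≤ W [])
    (hnone : ∀ h x, W h ≤ W (h ++ [(x, none)]))
    (hsome : ∀ A h x (f : ℝ → ℝ≥0∞), W h * expect (ρ A h x) f ^ 2 ≤
      expect (ρ' A h x) fun z => W (h ++ [(x, some z)]) * f z ^ 2)
    (i : ℕ) (f : (ι → K) × History X → ℝ≥0∞) :
    expect (seedPlay L ρ adv i) f ^ 2 ≤ expect (seedPlay L ρ' adv i) fun c => W c.2 * f c ^ 2 := by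
  induction i generalizing f with
  | zero =>
    simp only [seedPlay, expect_map]
    exact (sq_expect_le _ _).trans (expect_mono fun A => le_mul_of_one_le_left zero_le hnil)
  | succ i ih =>
    simp only [seedPlay, expect_bind]
    exact (ih _).trans
      (expect_mono fun c => mul_sq_expect_seedRound_le L ρ ρ' adv hnone hsome c f)

/-- The expectation of `f` after the seed of the sketch `j` alone has been drawn anew. -/
def resample (j : ι) (f : (ι → K) × History X → ℝ≥0∞) (c : (ι → K) × History X) : ℝ≥0∞ :=
  expect (PMF.uniformOfFintype K) fun a => f (Function.update c.1 j a, c.2)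

lemma expect_renewSeeds_resample (k : ℕ) (j : ι) (f : (ι → K) × History X → ℝ≥0∞)
    (A : ι → K) (h : History X) :
    expect (renewSeeds L k A) (fun A' => resample j f (A', h)) =
      expect (PMF.uniformOfFintype K) fun a =>
        expect (renewSeeds L k (Function.update A j a)) fun A' => f (A', h) := by
  unfold renewSeeds resample
  split_ifs
  · rw [expect_const]
    exact expect_uniform_update j fun A => f (A, h)
  · simp only [expect_pure]

variable {L ρ adv} {e : ℕ} {j : ι}

lemma expect_seedRound_resample_of_forall_update_eq {c : (ι → K) × History X}
    (hρ : ∀ x a, ρ (Function.update c.1 j a) c.2 x = ρ c.1 c.2 x)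
    (f : (ι → K) × History X → ℝ≥0∞) :
    expect (seedRound L ρ adv c) (resample j f) =
      resample j (fun c => expect (seedRound L ρ adv c) f) c := by
  simp only [expect_seedRound, expect_renewSeeds_resample]
  simp only [resample, hρ]
  rw [expect_comm (PMF.uniformOfFintype K) (adv c.2)]
  refine expect_congr fun move _ => ?_
  split_ifs
  · rw [expect_comm]
  · rfl

/-- The epoch `e` can be entered from outside only by a round that draws all seeds anew. -/
lemma expect_seedRound_resample_of_queries_div_ne {c : (ι → K) × History X}
    (hc : c.2.queries / L ≠ e) {f : (ι → K) × History X → ℝ≥0∞}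
    (hf : ∀ c, c.2.queries / L ≠ e → f c = 0) :
    expect (seedRound L ρ adv c) (resample j f) = expect (seedRound L ρ adv c) f := by
  have resample_eq_zero {A : ι → K} {h : History X} (hh : h.queries / L ≠ e) :
      resample j f (A, h) = 0 := by
    simp only [resample, hf (_, h) hh, expect_const]
  simp only [expect_seedRound]
  refine expect_congr fun move _ => ?_
  split_ifs
  · refine expect_congr fun z _ => ?_
    by_cases hL : L ∣ c.2.queries + 1
    · rw [expect_renewSeeds_resample]
      simp only [renewSeeds, if_pos hL, expect_const]
    · have hq : History.queries (c.2 ++ [(move.1, some z)]) / L ≠ e := by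
        rwa [History.queries_append_some, Nat.succ_div_of_not_dvd hL]
      simp only [resample_eq_zero hq, hf (_, _) hq]
  · have hq : History.queries (c.2 ++ [(move.1, none)]) / L ≠ e := by
      rwa [History.queries_append_none]
    rw [resample_eq_zero hq, hf (_, _) hq]

/-- If within the epoch `e` the responses do not depend on the seed of the sketch `j`, then this
seed is independent of the history. -/
lemma expect_seedPlay_resample
    (hρ : ∀ A h x a, h.queries / L = e → ρ (Function.update A j a) h x = ρ A h x) (i : ℕ)
    {f : (ι → K) × History X → ℝ≥0∞} (hf : ∀ c, c.2.queries / L ≠ e → f c = 0) :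
    expect (seedPlay L ρ adv i) (resample j f) = expect (seedPlay L ρ adv i) f := by
  induction i generalizing f with
  | zero =>
    simp only [seedPlay, expect_map, resample]
    exact expect_uniform_update j fun A => f (A, [])
  | succ i ih =>
    let g c := expect (seedRound L ρ adv c) f
    let S : Set ((ι → K) × History X) := {c | c.2.queries / L = e}
    have split_round (c) : expect (seedRound L ρ adv c) (resample j f) =
        resample j (S.indicator g) c + Sᶜ.indicator g c := by
      by_cases hc : c.2.queries / L = e
      · rw [expect_seedRound_resample_of_forall_update_eq fun x a => hρ _ _ _ _ hc]
        simp [resample, S, g, hc]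
      · rw [expect_seedRound_resample_of_queries_div_ne hc hf]
        simp [resample, S, g, hc, expect_const]
    simp only [seedPlay, expect_bind]
    simp only [split_round]
    rw [expect_add, ih fun c hc => Set.indicator_of_notMem (show c ∉ S from hc) g, ← expect_add]
    simp only [Set.indicator_self_add_compl_apply, g]

end SeedGame

/-! ### Voting sketches against adaptive adversaries -/

/-- A linear sketch with seeds in `K` and counters in `G`, which an update changes by an `increment`
that does not depend on the earlier updates. The counters determine the set of the candidates in `Z`
that the sketch votes for, where the candidate `z` stands for the response `val z`. -/
structure VotingSketch (X K G Z : Type*) where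
  increment : K → X → G
  vote : G → Set Z
  val : Z → ℝ

namespace VotingSketch

variable {X : Type} {ι K G Z : Type*} [AddCommGroup G] (Q : VotingSketch X K G Z)

/-- The counters of the sketch with the seed `k` at the end of the stream `u`. -/
def counters (k : K) (u : List X) : G := (u.map (Q.increment k)).sum

lemma counters_append (k : K) (u : List X) (x : X) :
    Q.counters k (u ++ [x]) = Q.counters k u + Q.increment k x := by
  simp [counters]

/-- The candidates that the sketch with the seed `k` votes for at the end of the stream `u`. -/
def votes (k : K) (u : List X) : Set Z := Q.vote (Q.counters k u)

/-- After the stream `u` the sketch with the seed `k` votes for the candidate `target u`, and only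
for candidates that are `α`-accurate for `g`. -/
def IsGood (g : List X → ℝ) (α : ℝ) (target : List X → Z) (u : List X) (k : K) : Prop :=
  target u ∈ Q.votes k u ∧ ∀ z ∈ Q.votes k u, |Q.val z - g u| ≤ α * |g u|

/-- For every fixed stream of length at most `m`, a random seed is good except with probability at
most `p`. -/
def FailsWithProbLE [Fintype K] [Nonempty K] (g : List X → ℝ) (α : ℝ) (target : List X → Z)
    (m : ℕ) (p : ℝ≥0∞) : Prop :=
  ∀ u : List X, u.length ≤ m →
    (PMF.uniformOfFintype K).toOuterMeasure {k | ¬ Q.IsGood g α target u k} ≤ p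

/-- The probability that the seed of the sketch `j` is not good after the next update. -/
def failNext (g : List X → ℝ) (α : ℝ) (target : List X → Z) (adv : Adversary X) (j : ι)
    (c : (ι → K) × History X) : ℝ≥0∞ :=
  expect (adv c.2) fun move =>
    Set.indicator {k | ¬ Q.IsGood g α target (c.2.stream ++ [move.1]) k} 1 (c.1 j)

lemma failNext_le_one (g : List X → ℝ) (α : ℝ) (target : List X → Z) (adv : Adversary X) (j : ι)
    (c : (ι → K) × History X) : Q.failNext g α target adv j c ≤ 1 :=
  expect_le_of_forall_le fun _ _ => Set.indicator_le_self' (by simp) _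

lemma FailsWithProbLE.resample_failNext_le [DecidableEq ι] [Fintype K] [Nonempty K]
    {Q : VotingSketch X K G Z} {g : List X → ℝ} {α : ℝ} {target : List X → Z} {m : ℕ} {p : ℝ≥0∞}
    (hQ : Q.FailsWithProbLE g α target m p) (adv : Adversary X) (j : ι) {c : (ι → K) × History X}
    (hc : c.2.length < m) : resample j (Q.failNext g α target adv j) c ≤ p := by
  simp only [resample, failNext]
  rw [expect_comm]
  refine expect_le_of_forall_le fun move _ => ?_
  simp only [Function.update_self]
  rw [expect_indicator_one]
  refine hQ _ ?_
  rw [List.length_append, History.length_stream, List.length_singleton]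
  omega

variable [Fintype Z] [Nonempty Z]

/-- The response after the stream `u`, computed from the votes of the sketches in `J` with the
seeds `A`. -/
def answer (θ : ℝ≥0) (J : Finset ι) (A : ι → K) (u : List X) : PMF ℝ :=
  (select θ J fun i => Q.votes (A i) u).map Q.val

variable [Fintype ι]

/-- The response computed from the votes of all sketches. -/
def answerAll (θ : ℝ≥0) (A : ι → K) (h : History X) (x : X) : PMF ℝ :=
  Q.answer θ Finset.univ A (h.stream ++ [x])

/-- The response computed from the votes of all sketches, except that the sketch `j` is ignored
during the epoch `e`. -/
def answerWithout [DecidableEq ι] (θ : ℝ≥0) (L e : ℕ) (j : ι) (A : ι → K) (h : History X)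
    (x : X) : PMF ℝ :=
  Q.answer θ (if h.queries / L = e then Finset.univ.erase j else Finset.univ) A (h.stream ++ [x])

lemma answerWithout_update [DecidableEq ι] (θ : ℝ≥0) {L e : ℕ} {j : ι} {h : History X}
    (he : h.queries / L = e) (A : ι → K) (x : X) (a : K) :
    Q.answerWithout θ L e j (Function.update A j a) h x = Q.answerWithout θ L e j A h x := by
  simp only [answerWithout, if_pos he, answer]
  rw [select_congr θ fun i hi => by rw [Function.update_of_ne (Finset.ne_of_mem_erase hi)]]

variable {g : List X → ℝ} {α : ℝ} {target : List X → Z} {A : ι → K} {u : List X}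

lemma expect_answer_indicator_le_of_forall_isGood (θ : ℝ≥0)
    (hA : ∀ j, Q.IsGood g α target u (A j)) :
    expect (Q.answer θ Finset.univ A u) (Set.indicator {z | ¬ |z - g u| ≤ α * |g u|} 1) ≤
      Fintype.card Z * ((1 + θ : ℝ≥0∞) ^ Fintype.card ι)⁻¹ := by
  rw [answer, expect_map]
  exact expect_select_indicator_le (z₀ := target u) (B := {z | ¬ |Q.val z - g u| ≤ α * |g u|}) θ
    (fun j _ => (hA j).1) fun z hz j _ hzj => hz ((hA j).2 z hzj)

lemma expect_answer_indicator_le (θ : ℝ≥0) (target : List X → Z) (A : ι → K) (u : List X) :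
    expect (Q.answer θ Finset.univ A u) (Set.indicator {z | ¬ |z - g u| ≤ α * |g u|} 1) ≤
      ∑ j, Set.indicator {k | ¬ Q.IsGood g α target u k} 1 (A j) +
        Fintype.card Z * ((1 + θ : ℝ≥0∞) ^ Fintype.card ι)⁻¹ := by
  by_cases hA : ∀ j, Q.IsGood g α target u (A j)
  · exact (Q.expect_answer_indicator_le_of_forall_isGood θ hA).trans le_add_self
  · obtain ⟨j, hj⟩ := not_forall.1 hA
    calc expect (Q.answer θ Finset.univ A u) (Set.indicator {z | ¬ |z - g u| ≤ α * |g u|} 1)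
        ≤ 1 := expect_le_of_forall_le fun _ _ => Set.indicator_le_self' (by simp) _
      _ = Set.indicator {k | ¬ Q.IsGood g α target u k} 1 (A j) := by simp [hj]
      _ ≤ ∑ j, Set.indicator {k | ¬ Q.IsGood g α target u k} 1 (A j) :=
          Finset.single_le_sum (f := fun j => Set.indicator _ (1 : K → ℝ≥0∞) (A j))
            (fun _ _ => zero_le) (Finset.mem_univ j)
      _ ≤ _ := le_self_add

variable [DecidableEq ι] [Fintype K] [Nonempty K] {L : ℕ} {adv : Adversary X}

lemma expect_seedRound_not_accurate_le (θ : ℝ≥0) (target : List X → Z)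
    (c : (ι → K) × History X) :
    expect (seedRound L (Q.answerAll θ) adv c)
        (fun c => Set.indicator {h | ¬ History.Accurate g α h} 1 c.2) ≤
      Set.indicator {h | ¬ History.Accurate g α h} 1 c.2 +
        (∑ j, Q.failNext g α target adv j c +
          Fintype.card Z * ((1 + θ : ℝ≥0∞) ^ Fintype.card ι)⁻¹) := by
  by_cases hc : c.2.Accurate g α
  · rw [Set.indicator_of_notMem (by simpa using hc), zero_add, expect_seedRound_history]
    simp only [failNext]
    rw [← expect_sum, ← expect_const (adv c.2) (Fintype.card Z * _), ← expect_add]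
    refine expect_mono fun move => ?_
    split_ifs
    · refine le_trans (expect_mono fun z => ?_)
        (Q.expect_answer_indicator_le θ target c.1 (c.2.stream ++ [move.1]))
      simp [Set.indicator, History.accurate_append_some_iff, hc]
    · simp [History.accurate_append_none_iff, hc]
  · rw [Set.indicator_of_mem (by simpa using hc)]
    exact (expect_le_of_forall_le fun _ _ => Set.indicator_le_self' (by simp) _).trans
      le_self_add

lemma sq_expect_answerAll_le (θ : ℝ≥0) (hL : 0 < L) (e : ℕ) (j : ι) (i : ℕ)
    (f : (ι → K) × History X → ℝ≥0∞) :
    expect (seedPlay L (Q.answerAll θ) adv i) f ^ 2 ≤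
      expect (seedPlay L (Q.answerWithout θ L e j) adv i) fun c =>
        (1 + θ ^ 2) ^ (c.2.queries - e * L) * f c ^ 2 := by
  have one_le : (1 : ℝ≥0∞) ≤ 1 + θ ^ 2 := le_self_add
  refine sq_expect_seedPlay_le L _ _ adv (W := fun h => (1 + θ ^ 2) ^ (h.queries - e * L))
    (one_le_pow₀ one_le) (fun h x => by rw [History.queries_append_none])
    (fun A h x f => ?_) i f
  simp only [History.queries_append_some]
  rw [expect_const_mul]
  unfold answerAll answerWithout
  split_ifs with he
  · have hle : e * L ≤ h.queries := (Nat.le_div_iff_mul_le hL).1 he.ge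
    rw [Nat.sub_add_comm hle, pow_succ _ (_ - _), mul_assoc]
    refine mul_le_mul_right ?_ _
    simp only [answer, expect_map]
    exact sq_expect_select_le θ (Finset.mem_univ j) _ _
  · exact mul_le_mul' (pow_le_pow_right₀ one_le (by omega)) (sq_expect_le _ _)

variable {Q} {θ : ℝ≥0} {m : ℕ} {p δ : ℝ≥0∞}

/-- During the epoch `e` the votes of the sketch `j` hardly influence the history, so its seed is
almost as good as one that is independent of the stream. -/
lemma FailsWithProbLE.expect_failNext_epoch_le
    (hQ : Q.FailsWithProbLE g α target m p) (hL : 0 < L)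
    (hδ : (1 + θ ^ 2) ^ min L m * p ≤ δ ^ 2) (e : ℕ) (j : ι) {i : ℕ} (hi : i < m) :
    expect (seedPlay L (Q.answerAll θ) adv i)
      (Set.indicator {c | c.2.queries / L = e} (Q.failNext g α target adv j)) ≤ δ := by
  set S : Set ((ι → K) × History X) := {c | c.2.queries / L = e}
  set f := S.indicator (Q.failNext g α target adv j)
  have f_le_one (c) : f c ≤ 1 :=
    (Set.indicator_le_self _ _ c).trans (Q.failNext_le_one g α target adv j c)
  refine (ENNReal.pow_le_pow_left_iff two_ne_zero).1 ?_
  calc expect (seedPlay L (Q.answerAll θ) adv i) f ^ 2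
      ≤ expect (seedPlay L (Q.answerWithout θ L e j) adv i) fun c =>
          (1 + θ ^ 2) ^ (c.2.queries - e * L) * f c ^ 2 := Q.sq_expect_answerAll_le θ hL e j i f
    _ ≤ expect (seedPlay L (Q.answerWithout θ L e j) adv i) fun c =>
          (1 + θ ^ 2) ^ min L m * f c := by
        refine expect_mono_support fun c hcs => ?_
        by_cases hc : c.2.queries / L = e
        · have hlt : c.2.queries < (e + 1) * L := (Nat.div_lt_iff_lt_mul hL).1 (by omega)
          have hlen := length_of_mem_support_seedPlay hcs
          have := c.2.queries_le_length
          rw [add_mul] at hlt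
          gcongr
          · exact le_self_add
          · exact le_min (by omega) (by omega)
          · exact pow_le_of_le_one zero_le (f_le_one c) two_ne_zero
        · simp [f, S, hc]
    _ = (1 + θ ^ 2) ^ min L m *
          expect (seedPlay L (Q.answerWithout θ L e j) adv i) (resample j f) := by
        rw [expect_const_mul, expect_seedPlay_resample (e := e)
          (fun A h x a he => Q.answerWithout_update θ he A x a) i
          fun c hc => Set.indicator_of_notMem (show c ∉ S from hc) _]
    _ ≤ (1 + θ ^ 2) ^ min L m * p := by
        gcongr
        refine expect_le_of_forall_le fun c hc => ?_
        refine le_trans (expect_mono fun a => ?_) (hQ.resample_failNext_le adv j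
          ((length_of_mem_support_seedPlay hc).trans_lt hi))
        exact Set.indicator_le_self _ _ _
    _ ≤ δ ^ 2 := hδ

lemma FailsWithProbLE.expect_failNext_le
    (hQ : Q.FailsWithProbLE g α target m p) (hL : 0 < L)
    (hδ : (1 + θ ^ 2) ^ min L m * p ≤ δ ^ 2) (j : ι) {i : ℕ} (hi : i < m) :
    expect (seedPlay L (Q.answerAll θ) adv i) (Q.failNext g α target adv j) ≤ m * δ := by
  calc expect (seedPlay L (Q.answerAll θ) adv i) (Q.failNext g α target adv j)
      ≤ expect (seedPlay L (Q.answerAll θ) adv i) fun c => ∑ e ∈ Finset.range m,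
          Set.indicator {c | c.2.queries / L = e} (Q.failNext g α target adv j) c := by
        refine expect_mono_support fun c hc => ?_
        have epoch_lt : c.2.queries / L < m := (Nat.div_le_self _ _).trans_lt
          (c.2.queries_le_length.trans_lt ((length_of_mem_support_seedPlay hc).trans_lt hi))
        refine le_trans ?_ (Finset.single_le_sum (fun _ _ => zero_le)
          (Finset.mem_range.2 epoch_lt))
        simp
    _ ≤ ∑ _e ∈ Finset.range m, δ := by
        rw [expect_sum]
        exact Finset.sum_le_sum fun e _ => hQ.expect_failNext_epoch_le hL hδ e j hi
    _ = m * δ := by simp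

theorem FailsWithProbLE.expect_not_accurate_le
    (hQ : Q.FailsWithProbLE g α target m p) (hL : 0 < L)
    (hδ : (1 + θ ^ 2) ^ min L m * p ≤ δ ^ 2) {i : ℕ} (hi : i ≤ m) :
    expect (seedPlay L (Q.answerAll (ι := ι) θ) adv i)
        (fun c => Set.indicator {h | ¬ History.Accurate g α h} 1 c.2) ≤
      i * (Fintype.card ι * (m * δ) +
        Fintype.card Z * ((1 + θ : ℝ≥0∞) ^ Fintype.card ι)⁻¹) := by
  induction i with
  | zero => simp [seedPlay, expect_map, expect_const, History.accurate_nil]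
  | succ i ih =>
    simp only [seedPlay, expect_bind]
    refine (expect_mono fun c => Q.expect_seedRound_not_accurate_le θ target c).trans ?_
    rw [expect_add, expect_add, expect_sum, expect_const]
    have sum_failNext_le : ∑ j : ι, expect (seedPlay L (Q.answerAll θ) adv i)
        (Q.failNext g α target adv j) ≤ Fintype.card ι * (m * δ) := by
      simpa using Finset.sum_le_sum fun j (_ : j ∈ Finset.univ) =>
        hQ.expect_failNext_le (adv := adv) hL hδ j hi
    push_cast
    rw [add_one_mul]
    gcongr
    exact ih (by omega)

end VotingSketch

/-! ### The streaming algorithm -/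

section StreamingAlgorithm

/-- An encoding of the elements of `M` by `S` bits. -/
structure BinaryCode (M : Type*) (S : ℕ) where
  enc : M → Fin S → Bool
  dec : (Fin S → Bool) → M
  dec_enc : ∀ s, dec (enc s) = s

lemma exists_binaryCode {M : Type*} [Fintype M] [Nonempty M] {S : ℕ}
    (h : Fintype.card M ≤ 2 ^ S) : Nonempty (BinaryCode M S) := by
  obtain ⟨f⟩ : Nonempty (M ↪ (Fin S → Bool)) := by
    rw [Function.Embedding.nonempty_iff_card_le]
    simpa using h
  exact ⟨⟨f, Function.invFun f, Function.leftInverse_invFun f.injective⟩⟩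

/-- The memory of the streaming algorithm. The sketches in use have seen the whole stream. Those of
the next generation have seen only the updates since their seeds were drawn; what they have missed
is learned from `N` bits of advice. -/
structure Memory (ι K G : Type*) (N : ℕ) where
  seed : ι → K
  counter : ι → G
  nextSeed : ι → K
  nextCounter : ι → G
  /-- the number of bits of advice received since the seeds of the next generation were drawn -/
  pos : Fin N
  /-- these bits of advice, at the positions before `pos` -/
  bits : Fin N → Bool

variable {X : Type} {ι K G Z : Type*} {N η k : ℕ}

namespace Memory

lemma exists_binaryCode [Fintype ι] [Fintype K] [Nonempty K] [Fintype G] [Nonempty G] [NeZero N]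
    {a b : ℕ} (hK : Fintype.card K ≤ 2 ^ a) (hG : Fintype.card G ≤ 2 ^ b)
    (hN : N = Fintype.card ι * b) :
    Nonempty (BinaryCode (Memory ι K G N) (4 * Fintype.card ι * (a + b))) := by
  classical
  let e : (ι → K) × (ι → G) × (ι → K) × (ι → G) × Fin N × (Fin N → Bool) ≃ Memory ι K G N :=
    { toFun t := ⟨t.1, t.2.1, t.2.2.1, t.2.2.2.1, t.2.2.2.2.1, t.2.2.2.2.2⟩
      invFun s := (s.seed, s.counter, s.nextSeed, s.nextCounter, s.pos, s.bits) }
  have : Fintype (Memory ι K G N) := Fintype.ofEquiv _ e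
  have : Nonempty (Memory ι K G N) := e.nonempty_congr.1 inferInstance
  refine ASA.exists_binaryCode ?_
  have hKι : Fintype.card K ^ Fintype.card ι ≤ 2 ^ (Fintype.card ι * a) := by
    rw [mul_comm, pow_mul]
    exact Nat.pow_le_pow_left hK _
  have hGι : Fintype.card G ^ Fintype.card ι ≤ 2 ^ N := by
    rw [hN, mul_comm, pow_mul]
    exact Nat.pow_le_pow_left hG _
  rw [← Fintype.card_congr e]
  simp only [Fintype.card_prod, Fintype.card_fun, Fintype.card_fin, Fintype.card_bool]
  calc _ ≤ 2 ^ (Fintype.card ι * a) * (2 ^ N * (2 ^ (Fintype.card ι * a) *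
        (2 ^ N * (2 ^ N * 2 ^ N)))) := by
        gcongr
        exact Nat.lt_two_pow_self.le
    _ = 2 ^ (2 * (Fintype.card ι * a) + 4 * N) := by ring
    _ ≤ 2 ^ (4 * Fintype.card ι * (a + b)) :=
        Nat.pow_le_pow_right two_pos (by rw [hN]; nlinarith [Nat.zero_le (Fintype.card ι * a)])

variable [AddCommGroup G] (Q : VotingSketch X K G Z) (cG : BinaryCode (ι → G) N)

/-- What the counters of the next generation are missing: the contribution of the updates made
before its seeds were drawn. -/
def missing (s : Memory ι K G N) (u : List X) : ι → G :=
  fun j => Q.counters (s.nextSeed j) u - s.nextCounter j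

/-- The memory after an update. -/
def update (s : Memory ι K G N) (x : X) : Memory ι K G N :=
  { s with
    counter := fun j => s.counter j + Q.increment (s.seed j) x
    nextCounter := fun j => s.nextCounter j + Q.increment (s.nextSeed j) x }

lemma missing_update (s : Memory ι K G N) (u : List X) (x : X) :
    (s.update Q x).missing Q (u ++ [x]) = s.missing Q u := by
  funext j
  simp only [missing, update, VotingSketch.counters_append, add_sub_add_right_eq_sub]

/-- The memory is consistent with the stream `u` and with `k` bits of advice having been
received. -/
structure IsValid (s : Memory ι K G N) (u : List X) (k : ℕ) : Prop where
  counter_eq : s.counter = fun j => Q.counters (s.seed j) u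
  pos_eq : (s.pos : ℕ) = k % N
  bits_eq : ∀ q < s.pos, s.bits q = cG.enc (s.missing Q u) q

variable {Q cG} {s : Memory ι K G N} {u : List X}

lemma IsValid.update (hs : s.IsValid Q cG u k) (x : X) :
    (s.update Q x).IsValid Q cG (u ++ [x]) k where
  counter_eq := by
    funext j
    simp only [Memory.update, hs.counter_eq, VotingSketch.counters_append]
  pos_eq := hs.pos_eq
  bits_eq q hq := by
    rw [missing_update]
    exact hs.bits_eq q hq

lemma IsValid.bits_update (hs : s.IsValid Q cG u k) {q : Fin N} (hq : q ≤ s.pos) :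
    Function.update s.bits s.pos (cG.enc (s.missing Q u) s.pos) q =
      cG.enc (s.missing Q u) q := by
  rcases hq.eq_or_lt with rfl | hlt
  · exact Function.update_self ..
  · rw [Function.update_of_ne hlt.ne]
    exact hs.bits_eq q hlt

variable [Fintype ι] [DecidableEq ι] [Fintype K] [Nonempty K] [NeZero N]

variable (cG) in
/-- The memory after a bit of advice. The last of `N` bits completes the counters of the next
generation; this generation is then put into use, and the seeds of a new one are drawn. -/
def receive (s : Memory ι K G N) (a : Bool) : PMF (Memory ι K G N) :=
  if h : s.pos + 1 < N then
    PMF.pure { s with pos := ⟨s.pos + 1, h⟩, bits := Function.update s.bits s.pos a }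
  else
    (PMF.uniformOfFintype (ι → K)).map fun A =>
      { seed := s.nextSeed
        counter := s.nextCounter + cG.dec (Function.update s.bits s.pos a)
        nextSeed := A
        nextCounter := 0
        pos := 0
        bits := s.bits }

lemma IsValid.receive (hs : s.IsValid Q cG u k) {s' : Memory ι K G N}
    (hs' : s' ∈ (s.receive cG (cG.enc (s.missing Q u) s.pos)).support) :
    s'.IsValid Q cG u (k + 1) := by
  have hmod : (k + 1) % N = (s.pos + 1) % N := by rw [hs.pos_eq, Nat.mod_add_mod]
  unfold Memory.receive at hs'
  split_ifs at hs' with h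
  · obtain rfl := (PMF.mem_support_pure_iff _ _).1 hs'
    refine ⟨hs.counter_eq, ?_, fun q hq => hs.bits_update (Nat.lt_succ_iff.1 hq)⟩
    rw [hmod, Nat.mod_eq_of_lt h]
  · obtain ⟨A, -, rfl⟩ := (PMF.mem_support_map_iff _ _ _).1 hs'
    have hpos : (s.pos : ℕ) + 1 = N := by omega
    have hbits : Function.update s.bits s.pos (cG.enc (s.missing Q u) s.pos) =
        cG.enc (s.missing Q u) :=
      funext fun q => hs.bits_update (Fin.le_def.2 (by omega))
    refine ⟨?_, ?_, fun q hq => absurd hq (Fin.not_lt_zero q)⟩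
    · funext j
      simp only [hbits, cG.dec_enc, Pi.add_apply, missing, add_sub_cancel]
    · rw [hmod, hpos, Nat.mod_self, Fin.val_zero]

end Memory

variable [Fintype ι] [DecidableEq ι] [Fintype K] [Nonempty K]

/-- The seeds of two generations of sketches after `k` queries: the next generation replaces the
current one when `L ∣ k`. -/
def rotateSeeds (L k : ℕ) (A : (ι → K) × (ι → K)) : PMF ((ι → K) × (ι → K)) :=
  if L ∣ k then (PMF.uniformOfFintype (ι → K)).map fun B => (A.2, B) else PMF.pure A

/-- One round of the seed game with two generations of seeds, of which the first is used by the
responses. -/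
def rotateRound (L : ℕ) (ρ : (ι → K) → History X → X → PMF ℝ) (adv : Adversary X)
    (c : ((ι → K) × (ι → K)) × History X) : PMF (((ι → K) × (ι → K)) × History X) :=
  (adv c.2).bind fun move =>
  if move.2 = true then
    (ρ c.1.1 c.2 move.1).bind fun z =>
    (rotateSeeds L (c.2.queries + 1) c.1).map fun A => (A, c.2 ++ [(move.1, some z)])
  else PMF.pure (c.1, c.2 ++ [(move.1, none)])

lemma expect_uniform_rotateSeeds (L k : ℕ) (A : ι → K) (f : (ι → K) × (ι → K) → ℝ≥0∞) :
    expect (PMF.uniformOfFintype (ι → K)) (fun B => expect (rotateSeeds L k (A, B)) f) =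
      expect (renewSeeds L k A) fun A' =>
        expect (PMF.uniformOfFintype (ι → K)) fun B => f (A', B) := by
  unfold rotateSeeds renewSeeds
  split_ifs
  · simp only [expect_map]
  · simp only [expect_pure]

lemma expect_rotateRound (L : ℕ) (ρ : (ι → K) → History X → X → PMF ℝ) (adv : Adversary X)
    (c : ((ι → K) × (ι → K)) × History X) (f : ((ι → K) × (ι → K)) × History X → ℝ≥0∞) :
    expect (rotateRound L ρ adv c) f = expect (adv c.2) fun move =>
      if move.2 = true then
        expect (ρ c.1.1 c.2 move.1) fun z =>
          expect (rotateSeeds L (c.2.queries + 1) c.1) fun A => f (A, c.2 ++ [(move.1, some z)])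
      else f (c.1, c.2 ++ [(move.1, none)]) := by
  rw [rotateRound, expect_bind]
  refine expect_congr fun move _ => ?_
  split_ifs
  · simp only [expect_bind, expect_map]
  · rw [expect_pure]

/-- The seeds of the next generation do not influence the responses: they can as well be drawn when
they are put into use. -/
lemma expect_uniform_rotateRound (L : ℕ) (ρ : (ι → K) → History X → X → PMF ℝ)
    (adv : Adversary X) (A : ι → K) (h : History X)
    (f : ((ι → K) × (ι → K)) × History X → ℝ≥0∞) :
    expect (PMF.uniformOfFintype (ι → K)) (fun B => expect (rotateRound L ρ adv ((A, B), h)) f) =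
      expect (seedRound L ρ adv (A, h)) fun c =>
        expect (PMF.uniformOfFintype (ι → K)) fun B => f ((c.1, B), c.2) := by
  simp only [expect_rotateRound, expect_seedRound]
  rw [expect_comm]
  refine expect_congr fun move _ => ?_
  split_ifs
  · rw [expect_comm]
    refine expect_congr fun z _ => ?_
    exact expect_uniform_rotateSeeds L _ A fun A => f (A, h ++ [(move.1, some z)])
  · rfl

lemma mul_dvd_succ_iff_of_dvd (hN : 0 < N) (hk : η ∣ k + 1) :
    η * N ∣ k + 1 ↔ ¬ k / η % N + 1 < N := by
  rw [← Nat.dvd_div_iff_mul_dvd hk, Nat.succ_div_of_dvd hk]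
  have hlt := Nat.mod_lt (k / η) hN
  rw [Nat.dvd_iff_mod_eq_zero, ← Nat.mod_add_mod]
  constructor
  · intro h0 hsucc
    rw [Nat.mod_eq_of_lt hsucc] at h0
    omega
  · intro hsucc
    rw [show k / η % N + 1 = N by omega, Nat.mod_self]

lemma Memory.expect_receive [NeZero N] {cG : BinaryCode (ι → G) N} [AddCommGroup G]
    {s : Memory ι K G N} (hpos : (s.pos : ℕ) = k / η % N) (hk : η ∣ k + 1) (a : Bool)
    (f : (ι → K) × (ι → K) → ℝ≥0∞) :
    expect (s.receive cG a) (fun s' => f (s'.seed, s'.nextSeed)) =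
      expect (rotateSeeds (η * N) (k + 1) (s.seed, s.nextSeed)) f := by
  simp only [receive, rotateSeeds, mul_dvd_succ_iff_of_dvd (NeZero.pos N) hk, hpos]
  split_ifs
  · simp only [expect_pure]
  · simp only [expect_map]

variable {S : ℕ} [AddCommGroup G] [Fintype Z] [Nonempty Z] [NeZero N]
  (Q : VotingSketch X K G Z) (θ : ℝ≥0) (cG : BinaryCode (ι → G) N)
  (cM : BinaryCode (Memory ι K G N) S)

/-- The streaming algorithm which responds according to `Q.answerAll θ`. -/
def sketchAlgorithm : Algorithm X S where
  init := (PMF.uniformOfFintype (ι → K)).bind fun A =>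
    (PMF.uniformOfFintype (ι → K)).map fun B => cM.enc ⟨A, 0, B, 0, 0, fun _ => false⟩
  update s x := PMF.pure (cM.enc ((cM.dec s).update Q x))
  respond s := (select θ Finset.univ fun j => Q.vote ((cM.dec s).counter j)).map
    fun z => (s, Q.val z)
  predicate s u := cG.enc ((cM.dec s).missing Q u) (cM.dec s).pos
  receive s a := ((cM.dec s).receive cG a).map cM.enc

variable (η) in
/-- The memory is consistent with the history, in the game with query/advice rate `η`. -/
def IsValidConfig (c : (Fin S → Bool) × History X) : Prop :=
  (cM.dec c.1).IsValid Q cG c.2.stream (c.2.queries / η)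

/-- A configuration of the game, with all but the seeds and the history forgotten. -/
def seedsAndHistory (c : (Fin S → Bool) × History X) : ((ι → K) × (ι → K)) × History X :=
  (((cM.dec c.1).seed, (cM.dec c.1).nextSeed), c.2)

variable {Q cG cM θ} {adv : Adversary X} {i : ℕ}

lemma IsValidConfig.of_mem_support_playRound {c c' : (Fin S → Bool) × History X}
    (hc : IsValidConfig η Q cG cM c)
    (hc' : c' ∈ (playRound η (sketchAlgorithm Q θ cG cM) adv c).support) :
    IsValidConfig η Q cG cM c' := by
  simp only [playRound, sketchAlgorithm, PMF.pure_bind, PMF.mem_support_bind_iff] at hc'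
  obtain ⟨move, -, hc'⟩ := hc'
  have hu := Memory.IsValid.update hc move.1
  split_ifs at hc' with hmove
  · simp only [PMF.mem_support_bind_iff, PMF.mem_support_map_iff] at hc'
    obtain ⟨_, ⟨z, -, rfl⟩, hc'⟩ := hc'
    rw [History.queries_append_some] at hc'
    split_ifs at hc' with hη
    · simp only [PMF.mem_support_bind_iff, PMF.mem_support_map_iff, PMF.mem_support_pure_iff,
        cM.dec_enc, History.stream_append] at hc'
      obtain ⟨_, ⟨s, hs, rfl⟩, rfl⟩ := hc'
      simp only [IsValidConfig, cM.dec_enc, History.stream_append, History.queries_append_some]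
      rw [Nat.succ_div_of_dvd (Nat.dvd_of_mod_eq_zero hη)]
      exact hu.receive hs
    · obtain rfl := (PMF.mem_support_pure_iff _ _).1 hc'
      simp only [IsValidConfig, cM.dec_enc, History.stream_append, History.queries_append_some]
      rwa [Nat.succ_div_of_not_dvd fun hd => hη (Nat.mod_eq_zero_of_dvd hd)]
  · obtain rfl := (PMF.mem_support_pure_iff _ _).1 hc'
    simp only [IsValidConfig, cM.dec_enc, History.stream_append, History.queries_append_none]
    exact hu

lemma isValidConfig_of_mem_support_play {c : (Fin S → Bool) × History X}
    (hc : c ∈ (play η (sketchAlgorithm Q θ cG cM) adv i).support) :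
    IsValidConfig η Q cG cM c := by
  induction i generalizing c with
  | zero =>
    simp only [play, sketchAlgorithm, PMF.mem_support_bind_iff, PMF.mem_support_map_iff,
      PMF.mem_support_pure_iff] at hc
    obtain ⟨_, ⟨A, -, B, -, rfl⟩, rfl⟩ := hc
    simp only [IsValidConfig, cM.dec_enc]
    refine ⟨?_, ?_, fun q hq => absurd hq (Fin.not_lt_zero q)⟩
    · funext j
      simp [VotingSketch.counters, History.stream]
    · simp [History.queries]
  | succ i ih =>
    rw [play, PMF.mem_support_bind_iff] at hc
    obtain ⟨c₀, hc₀, hc⟩ := hc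
    exact (ih hc₀).of_mem_support_playRound hc

lemma expect_playRound {c : (Fin S → Bool) × History X} (hc : IsValidConfig η Q cG cM c)
    (f : ((ι → K) × (ι → K)) × History X → ℝ≥0∞) :
    expect (playRound η (sketchAlgorithm Q θ cG cM) adv c) (fun c' => f (seedsAndHistory cM c')) =
      expect (rotateRound (η * N) (Q.answerAll θ) adv (seedsAndHistory cM c)) f := by
  simp only [expect_rotateRound, playRound, sketchAlgorithm, PMF.pure_bind, expect_bind,
    cM.dec_enc]
  refine expect_congr fun move _ => ?_
  have hu := Memory.IsValid.update hc move.1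
  split_ifs with hmove
  · rw [expect_bind, expect_map, VotingSketch.answerAll, VotingSketch.answer, expect_map,
      hu.counter_eq]
    refine expect_congr fun z _ => ?_
    rw [History.queries_append_some]
    split_ifs with hη
    · simp only [expect_bind, expect_map, expect_pure, seedsAndHistory, cM.dec_enc]
      exact Memory.expect_receive hu.pos_eq (Nat.dvd_of_mod_eq_zero hη) _
        fun A => f (A, c.2 ++ [(move.1, some (Q.val z))])
    · have not_rotate (A : (ι → K) × (ι → K)) :
          rotateSeeds (η * N) (c.2.queries + 1) A = PMF.pure A :=
        if_neg fun h => hη (Nat.mod_eq_zero_of_dvd ((Dvd.intro N rfl).trans h))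
      simp only [expect_pure, seedsAndHistory, not_rotate, cM.dec_enc]
      rfl
  · simp only [expect_pure, seedsAndHistory, cM.dec_enc]
    rfl

theorem expect_play (f : ((ι → K) × (ι → K)) × History X → ℝ≥0∞) :
    expect (play η (sketchAlgorithm Q θ cG cM) adv i) (fun c => f (seedsAndHistory cM c)) =
      expect (seedPlay (η * N) (Q.answerAll θ) adv i) fun c =>
        expect (PMF.uniformOfFintype (ι → K)) fun B => f ((c.1, B), c.2) := by
  induction i generalizing f with
  | zero =>
    simp only [play, seedPlay, sketchAlgorithm, expect_bind, expect_map, expect_pure,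
      seedsAndHistory, cM.dec_enc]
  | succ i ih =>
    rw [play, seedPlay, expect_bind, expect_bind,
      expect_congr fun c hc => expect_playRound (isValidConfig_of_mem_support_play hc) f,
      ih fun c => expect (rotateRound (η * N) (Q.answerAll θ) adv c) f]
    simp only [expect_uniform_rotateRound]

end StreamingAlgorithm

lemma isRobust_of_expect_le {X : Type} {S : ℕ} {alg : Algorithm X S} {g : List X → ℝ} {η m : ℕ}
    {α β : ℝ} (hβ : 0 ≤ β)
    (h : ∀ adv : Adversary X, expect (play η alg adv m)
      (fun c => Set.indicator {h | ¬ History.Accurate g α h} 1 c.2) ≤ ENNReal.ofReal β) (T : ℕ) :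
    alg.IsRobust g η m T α β := by
  intro adv _
  rw [ENNReal.ofReal_sub 1 hβ, ENNReal.ofReal_one, tsub_le_iff_right, ← expect_indicator_one]
  refine le_trans ?_ (add_le_add_right (h adv) _)
  rw [← expect_add, ← expect_const (play η alg adv m) 1]
  refine expect_mono fun c => ?_
  by_cases hc : History.Accurate g α c.2 <;> simp [hc]

/-- The generation in use serves for `η * (r * b)` queries, as long as it takes to learn the
counters of the next one. -/
theorem VotingSketch.FailsWithProbLE.exists_isRobust {X : Type} {K G Z : Type*} [Fintype K]
    [Nonempty K] [AddCommGroup G] [Fintype G] [Fintype Z] [Nonempty Z]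
    {Q : VotingSketch X K G Z} {g : List X → ℝ} {α : ℝ} {target : List X → Z} {m : ℕ}
    {p : ℝ≥0∞} (hQ : Q.FailsWithProbLE g α target m p) {η r a b : ℕ} {β : ℝ} {θ : ℝ≥0}
    {δ : ℝ≥0∞} (hη : 0 < η) (hr : 0 < r) (hb : 0 < b) (hβ : 0 ≤ β)
    (hK : Fintype.card K ≤ 2 ^ a) (hG : Fintype.card G ≤ 2 ^ b)
    (hδ : (1 + (θ : ℝ≥0∞) ^ 2) ^ min (η * (r * b)) m * p ≤ δ ^ 2)
    (hfail : m * (r * (m * δ) + Fintype.card Z * ((1 + θ : ℝ≥0∞) ^ r)⁻¹) ≤ ENNReal.ofReal β) :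
    ∃ alg : Algorithm X (4 * r * (a + b)), ∀ T, alg.IsRobust g η m T α β := by
  have hN : 0 < r * b := Nat.mul_pos hr hb
  have : NeZero (r * b) := ⟨hN.ne'⟩
  obtain ⟨cM⟩ := Memory.exists_binaryCode (ι := Fin r) (N := r * b) hK hG (by simp)
  obtain ⟨cG⟩ : Nonempty (BinaryCode (Fin r → G) (r * b)) := by
    refine exists_binaryCode ?_
    rw [Fintype.card_fun, Fintype.card_fin, mul_comm, pow_mul]
    exact Nat.pow_le_pow_left hG r
  rw [Fintype.card_fin] at cM
  refine ⟨sketchAlgorithm Q θ cG cM, isRobust_of_expect_le hβ fun adv => le_trans ?_ hfail⟩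
  have hseed := hQ.expect_not_accurate_le (ι := Fin r) (adv := adv) (Nat.mul_pos hη hN) hδ le_rfl
  rw [Fintype.card_fin] at hseed
  refine (Eq.le ?_).trans hseed
  refine (expect_play fun c => Set.indicator {h | ¬ History.Accurate g α h} 1 c.2).trans ?_
  simp only [expect_const]

/-! ### Fourwise uncorrelated signs -/

/-- A family of sign vectors, indexed by the seeds `Ω`, of which any four entries are uncorrelated
for a uniformly random seed: the product of four entries has mean zero unless they agree in
pairs. -/
structure FourwiseUncorrelated {Ω ι R : Type*} [Fintype Ω] [CommRing R] (ε : Ω → ι → R) :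
    Prop where
  mul_self : ∀ s a, ε s a * ε s a = 1
  sum_eq_zero : ∀ {a b c d}, ¬ ((a = b ∧ c = d) ∨ (a = c ∧ b = d) ∨ (a = d ∧ b = c)) →
    ∑ s, ε s a * ε s b * (ε s c * ε s d) = 0

namespace FourwiseUncorrelated

section Moments

variable {Ω ι R : Type*} [Fintype Ω] [Fintype ι] [CommRing R] {ε : Ω → ι → R}

lemma sq_dotProduct_sub (hε : FourwiseUncorrelated ε) (v : ι → R) (s : Ω) :
    (ε s ⬝ᵥ v) ^ 2 - v ⬝ᵥ v =
    ∑ p ∈ Finset.univ.offDiag, v p.1 * v p.2 * (ε s p.1 * ε s p.2) := by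
  classical
  have diagonal : v ⬝ᵥ v =
      ∑ p ∈ Finset.univ.diag, v p.1 * v p.2 * (ε s p.1 * ε s p.2) := by
    rw [Finset.sum_diag]
    simp only [hε.mul_self, mul_one, dotProduct]
  have square : (ε s ⬝ᵥ v) ^ 2 =
      ∑ p ∈ Finset.univ ×ˢ Finset.univ, v p.1 * v p.2 * (ε s p.1 * ε s p.2) := by
    rw [sq, dotProduct, Finset.sum_mul_sum, Finset.sum_product]
    exact Finset.sum_congr rfl fun a _ => Finset.sum_congr rfl fun b _ => by ring
  rw [square, diagonal, ← Finset.diag_union_offDiag,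
    Finset.sum_union (Finset.disjoint_diag_offDiag _), add_sub_cancel_left]

lemma sum_sq_dotProduct_sub (hε : FourwiseUncorrelated ε) (v : ι → R) :
    ∑ s, ((ε s ⬝ᵥ v) ^ 2 - v ⬝ᵥ v) = 0 := by
  simp only [hε.sq_dotProduct_sub]
  rw [Finset.sum_comm]
  refine Finset.sum_eq_zero fun p hp => ?_
  have hne : p.1 ≠ p.2 := (Finset.mem_offDiag.1 hp).2.2
  rw [← Finset.mul_sum]
  have := hε.sum_eq_zero (a := p.1) (b := p.2) (c := p.1) (d := p.1) (by tauto)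
  simp only [hε.mul_self, mul_one] at this
  rw [this, mul_zero]

lemma sum_offDiag_mul (hε : FourwiseUncorrelated ε) (v : ι → R) {p : ι × ι} (hp : p.1 ≠ p.2) :
    ∑ q ∈ Finset.univ.offDiag, v q.1 * v q.2 *
      ∑ s, ε s p.1 * ε s p.2 * (ε s q.1 * ε s q.2) = 2 * Fintype.card Ω * (v p.1 * v p.2) := by
  classical
  have hswap : p ≠ p.swap := fun h => hp (Prod.ext_iff.1 h).1
  have hmem : p ∈ Finset.univ.offDiag := by simpa using hp
  have hmem_swap : p.swap ∈ Finset.univ.offDiag := by simpa using hp.symm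
  rw [Finset.sum_eq_add_of_mem p p.swap hmem hmem_swap hswap]
  · have mul_eq_one (s : Ω) : ε s p.1 * ε s p.2 * (ε s p.1 * ε s p.2) = 1 := by
      rw [mul_mul_mul_comm, hε.mul_self, hε.mul_self, one_mul]
    simp only [Prod.fst_swap, Prod.snd_swap, mul_comm (ε _ p.2), mul_eq_one, Finset.sum_const,
      Finset.card_univ, nsmul_eq_mul]
    ring
  · rintro ⟨c, d⟩ hcd ⟨hne, hne_swap⟩
    have : c ≠ d := (Finset.mem_offDiag.1 hcd).2.2
    rw [hε.sum_eq_zero, mul_zero]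
    rintro (⟨h, -⟩ | ⟨rfl, rfl⟩ | ⟨rfl, rfl⟩)
    · exact hp h
    · exact hne rfl
    · exact hne_swap rfl

lemma sum_sq_sq_dotProduct_sub (hε : FourwiseUncorrelated ε) (v : ι → R) :
    ∑ s, ((ε s ⬝ᵥ v) ^ 2 - v ⬝ᵥ v) ^ 2 =
    2 * Fintype.card Ω * ∑ p ∈ Finset.univ.offDiag, (v p.1 * v p.2) ^ 2 := by
  simp only [hε.sq_dotProduct_sub, sq (∑ _ ∈ Finset.univ.offDiag, _), Finset.sum_mul_sum]
  rw [Finset.sum_comm, Finset.mul_sum]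
  refine Finset.sum_congr rfl fun p hp => ?_
  rw [Finset.sum_comm]
  calc _ = v p.1 * v p.2 * ∑ q ∈ Finset.univ.offDiag, v q.1 * v q.2 *
        ∑ s, ε s p.1 * ε s p.2 * (ε s q.1 * ε s q.2) := by
        simp only [Finset.mul_sum]
        exact Finset.sum_congr rfl fun q _ => Finset.sum_congr rfl fun s _ => by ring
    _ = 2 * Fintype.card Ω * (v p.1 * v p.2) ^ 2 := by
        rw [hε.sum_offDiag_mul v (Finset.mem_offDiag.1 hp).2.2]
        ring

lemma sum_sq_sq_dotProduct_sub_le (hε : FourwiseUncorrelated ε) (v : ι → R)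
    [LinearOrder R] [IsStrictOrderedRing R] :
    ∑ s, ((ε s ⬝ᵥ v) ^ 2 - v ⬝ᵥ v) ^ 2 ≤ 2 * Fintype.card Ω * (v ⬝ᵥ v) ^ 2 := by
  rw [hε.sum_sq_sq_dotProduct_sub]
  gcongr
  calc ∑ p ∈ Finset.univ.offDiag, (v p.1 * v p.2) ^ 2
      ≤ ∑ p ∈ Finset.univ ×ˢ Finset.univ, (v p.1 * v p.2) ^ 2 :=
        Finset.sum_le_sum_of_subset_of_nonneg (Finset.subset_univ _) fun _ _ _ => sq_nonneg _
    _ = (v ⬝ᵥ v) ^ 2 := by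
        rw [sq (v ⬝ᵥ v), dotProduct, Finset.sum_mul_sum, Finset.sum_product]
        exact Finset.sum_congr rfl fun a _ => Finset.sum_congr rfl fun b _ => by ring

end Moments

section Field

variable {F : Type*} [Field F]

lemma sum_addChar_eq_zero [Fintype F] {ψ : AddChar F ℤ} (hψ : ψ.IsPrimitive) {a b : F}
    (hab : a ≠ 0 ∨ b ≠ 0) : ∑ s : F × F, ψ (s.1 * a + s.2 * b) = 0 := by
  classical
  simp only [Fintype.sum_prod_type, AddChar.map_add_eq_mul, ← Finset.mul_sum, ← Finset.sum_mul,
    AddChar.sum_mulShift _ hψ]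
  rcases hab with h | h <;> simp [h]

variable [CharP F 2]

lemma exists_isPrimitive_addChar [Finite F] : ∃ ψ : AddChar F ℤ, ψ.IsPrimitive := by
  let _ : Algebra (ZMod 2) F := ZMod.algebra F 2
  obtain ⟨φ, hφ⟩ : ∃ φ : F →ₗ[ZMod 2] ZMod 2, φ 1 = 1 :=
    Module.Projective.exists_dual_eq_one (ZMod 2) one_ne_zero
  let χ : AddChar (ZMod 2) ℤ := AddChar.zmodChar 2 (ζ := -1) (by norm_num)
  refine ⟨χ.compAddMonoidHom φ.toAddMonoidHom, AddChar.IsPrimitive.of_ne_one fun h => ?_⟩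
  have : χ (φ 1) = 1 := DFunLike.congr_fun h 1
  rw [hφ] at this
  exact absurd this (by decide)

/-- In characteristic two, four elements are determined up to pairs by the sums of their first and
of their third powers. -/
lemma eq_or_eq_or_eq_of_sum_eq_zero {a b c d : F} (h1 : a + b + c + d = 0)
    (h3 : a ^ 3 + b ^ 3 + c ^ 3 + d ^ 3 = 0) :
    (a = b ∧ c = d) ∨ (a = c ∧ b = d) ∨ (a = d ∧ b = c) := by
  have two_eq_zero : (2 : F) = 0 := CharTwo.two_eq_zero
  obtain rfl : a + b + c = d := CharTwo.add_eq_zero.1 h1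
  have factored : (a + b) * ((b + c) * (c + a)) = 0 := by
    linear_combination h3 -
      two_eq_zero * (a ^ 3 + b ^ 3 + c ^ 3 + (a + b) * (b + c) * (c + a))
  simp only [mul_eq_zero, CharTwo.add_eq_zero] at factored
  rcases factored with rfl | rfl | rfl
  · exact Or.inl ⟨rfl, by rw [CharTwo.add_self_eq_zero, zero_add]⟩
  · exact Or.inr (Or.inr ⟨by rw [CharTwo.add_cancel_right], rfl⟩)
  · exact Or.inr (Or.inl ⟨rfl, by linear_combination -c * two_eq_zero⟩)

lemma of_addChar [Fintype F] {ψ : AddChar F ℤ} (hψ : ψ.IsPrimitive) {ι : Type*} {y : ι → F}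
    (hy : Function.Injective y) :
    FourwiseUncorrelated fun (s : F × F) a => ψ (s.1 * y a + s.2 * y a ^ 3) where
  mul_self s a := by
    rw [← AddChar.map_add_eq_mul, CharTwo.add_self_eq_zero, AddChar.map_zero_eq_one]
  sum_eq_zero {a b c d} hne := by
    have mul_eq (s : F × F) : ψ (s.1 * y a + s.2 * y a ^ 3) * ψ (s.1 * y b + s.2 * y b ^ 3) *
        (ψ (s.1 * y c + s.2 * y c ^ 3) * ψ (s.1 * y d + s.2 * y d ^ 3)) =
        ψ (s.1 * (y a + y b + y c + y d) + s.2 * (y a ^ 3 + y b ^ 3 + y c ^ 3 + y d ^ 3)) := by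
      simp only [← AddChar.map_add_eq_mul]
      congr 1
      ring
    simp only [mul_eq]
    refine sum_addChar_eq_zero hψ ?_
    by_contra! hsum
    exact hne (by simpa only [hy.eq_iff] using eq_or_eq_or_eq_of_sum_eq_zero hsum.1 hsum.2)

end Field

end FourwiseUncorrelated

lemma exists_fourwiseUncorrelated {ι : Type*} [Fintype ι] {l : ℕ} (hl : l ≠ 0)
    (hι : Fintype.card ι ≤ 2 ^ l) :
    ∃ (Ω : Type) (_ : Fintype Ω) (ε : Ω → ι → ℤ),
      Fintype.card Ω = 4 ^ l ∧ FourwiseUncorrelated ε := by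
  let F := GaloisField 2 l
  let _ : Fintype F := Fintype.ofFinite F
  have card_F : Fintype.card F = 2 ^ l := by
    rw [← Nat.card_eq_fintype_card, GaloisField.card 2 l hl]
  obtain ⟨y⟩ : Nonempty (ι ↪ F) := Function.Embedding.nonempty_of_card_le (hι.trans card_F.ge)
  obtain ⟨ψ, hψ⟩ := FourwiseUncorrelated.exists_isPrimitive_addChar (F := F)
  refine ⟨F × F, inferInstance, _, ?_, .of_addChar hψ y.injective⟩
  rw [Fintype.card_prod, card_F, ← mul_pow]
  norm_num

/-! ### Averages and majorities of independent trials -/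

section Independent

variable {κ Ω : Type*} [Fintype κ] [Fintype Ω]

lemma card_mul_sum_sq_sum [DecidableEq κ] {R : Type*} [CommRing R] {g : Ω → R}
    (hg : ∑ s, g s = 0) :
    Fintype.card Ω * ∑ k : κ → Ω, (∑ j, g (k j)) ^ 2 =
      Fintype.card κ * (Fintype.card (κ → Ω) * ∑ s, g s ^ 2) := by
  have second_moment (i j : κ) : Fintype.card Ω * ∑ k : κ → Ω, g (k i) * g (k j) =
      if i = j then Fintype.card (κ → Ω) * ∑ s, g s ^ 2 else 0 := by
    rw [← nsmul_eq_mul, ← sum_sum_update i]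
    split_ifs with h
    · subst h
      simp only [Function.update_self, ← sq, Finset.sum_const, Finset.card_univ, nsmul_eq_mul]
    · refine Finset.sum_eq_zero fun k _ => ?_
      simp only [Function.update_self, Function.update_of_ne (Ne.symm h), ← Finset.sum_mul, hg,
        zero_mul]
  calc Fintype.card Ω * ∑ k : κ → Ω, (∑ j, g (k j)) ^ 2
      = ∑ i, ∑ j, Fintype.card Ω * ∑ k : κ → Ω, g (k i) * g (k j) := by
        simp only [sq, Finset.sum_mul_sum]
        simp only [Finset.mul_sum]
        rw [Finset.sum_comm]
        exact Finset.sum_congr rfl fun i _ => Finset.sum_comm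
    _ = Fintype.card κ * (Fintype.card (κ → Ω) * ∑ s, g s ^ 2) := by
        simp only [second_moment, Finset.sum_ite_eq, Finset.mem_univ, if_true, Finset.sum_const,
          Finset.card_univ, nsmul_eq_mul]

open scoped Classical in
lemma card_lt_abs_mul_sq_le {R : Type*} [CommRing R] [LinearOrder R] [IsStrictOrderedRing R]
    (g : Ω → R) {t : R} (ht : 0 ≤ t) :
    Finset.card {s | t < |g s|} * t ^ 2 ≤ ∑ s, g s ^ 2 :=
  calc Finset.card {s | t < |g s|} * t ^ 2
      = ∑ s with t < |g s|, t ^ 2 := by rw [Finset.sum_const, nsmul_eq_mul]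
    _ ≤ ∑ s with t < |g s|, g s ^ 2 := Finset.sum_le_sum fun s hs => by
        rw [← sq_abs (g s)]
        exact pow_le_pow_left₀ ht (Finset.mem_filter.1 hs).2.le 2
    _ ≤ ∑ s, g s ^ 2 :=
        Finset.sum_le_sum_of_subset_of_nonneg (Finset.filter_subset _ _) fun _ _ _ => sq_nonneg _

open scoped Classical in
/-- The property `P` holds for more than half of all indices. -/
def HoldsForMost (P : κ → Prop) : Prop := Fintype.card κ < 2 * Finset.card {i | P i}

lemma HoldsForMost.exists_and {P P' : κ → Prop} (h : HoldsForMost P) (h' : HoldsForMost P') :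
    ∃ i, P i ∧ P' i := by
  classical
  rw [HoldsForMost] at h h'
  obtain ⟨i, hi⟩ := Finset.inter_nonempty_of_card_lt_card_add_card
    (Finset.subset_univ {i | P i}) (Finset.subset_univ {i | P' i})
    (by rw [Finset.card_univ]; omega)
  exact ⟨i, by simpa using hi⟩

open scoped Classical in
/-- Markov's inequality for the product of the weights `1` of the successes and `16` of the
failures: its expectation is at most `2 ^ card κ`, but it is at least `4 ^ card κ` unless most of
the trials succeed. -/
lemma two_pow_mul_card_not_holdsForMost_le [DecidableEq κ] {P : Ω → Prop}
    (hP : 16 * Finset.card {s | ¬ P s} ≤ Fintype.card Ω) :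
    2 ^ Fintype.card κ * Finset.card {k : κ → Ω | ¬ HoldsForMost fun i => P (k i)} ≤
      Fintype.card (κ → Ω) := by
  let weight (s : Ω) : ℕ := if P s then 1 else 16
  have sum_weight : ∑ s, weight s ≤ 2 * Fintype.card Ω := by
    have : ∑ s, weight s = Finset.card {s | P s} + 16 * Finset.card {s | ¬ P s} := by
      simp only [weight, Finset.sum_ite, Finset.sum_const, smul_eq_mul, mul_one, mul_comm]
    have : Finset.card {s | P s} ≤ Fintype.card Ω := Finset.card_le_univ _
    omega
  have prod_weight {k : κ → Ω} (hk : ¬ HoldsForMost fun i => P (k i)) :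
      4 ^ Fintype.card κ ≤ ∏ i, weight (k i) := by
    have : Finset.card {i | P (k i)} + Finset.card {i | ¬ P (k i)} = Fintype.card κ :=
      Finset.card_filter_add_card_filter_not (s := Finset.univ) _
    rw [HoldsForMost] at hk
    calc 4 ^ Fintype.card κ ≤ 4 ^ (2 * Finset.card {i | ¬ P (k i)}) :=
          Nat.pow_le_pow_right (by norm_num) (by omega)
      _ = ∏ i, weight (k i) := by
          simp only [weight, Finset.prod_ite, Finset.prod_const, one_pow, one_mul, pow_mul]
          norm_num
  refine Nat.le_of_mul_le_mul_left ?_ (pow_pos two_pos (Fintype.card κ))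
  calc 2 ^ Fintype.card κ * (2 ^ Fintype.card κ *
        Finset.card {k : κ → Ω | ¬ HoldsForMost fun i => P (k i)})
      = ∑ k : κ → Ω with ¬ HoldsForMost fun i => P (k i), 4 ^ Fintype.card κ := by
        rw [Finset.sum_const, smul_eq_mul, ← mul_assoc, ← mul_pow, mul_comm]
        norm_num
    _ ≤ ∑ k : κ → Ω with ¬ HoldsForMost fun i => P (k i), ∏ i, weight (k i) :=
        Finset.sum_le_sum fun k hk => prod_weight (Finset.mem_filter.1 hk).2
    _ ≤ ∑ k : κ → Ω, ∏ i, weight (k i) := Finset.sum_le_sum_of_subset (Finset.filter_subset _ _)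
    _ = (∑ s, weight s) ^ Fintype.card κ := by
        rw [← Fintype.prod_sum, Finset.prod_const, Finset.card_univ]
    _ ≤ (2 * Fintype.card Ω) ^ Fintype.card κ := Nat.pow_le_pow_left sum_weight _
    _ = 2 ^ Fintype.card κ * Fintype.card (κ → Ω) := by rw [mul_pow, Fintype.card_fun]

end Independent

/-- The counters `c`, whose squares are unbiased estimates of a second moment, confirm the
candidate `z` for this second moment. -/
def Confirms {κ : Type*} [Fintype κ] (α : ℝ) (c : κ → ℤ) (z : ℝ) : Prop :=
  |∑ j, (c j : ℝ) ^ 2 - Fintype.card κ * z| ≤ α / 3 * (Fintype.card κ * z)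

lemma Confirms.abs_sub_le {κ : Type*} [Fintype κ] [Nonempty κ] {α : ℝ} (hα : 0 < α) (hα1 : α < 1)
    {c : κ → ℤ} {z f : ℝ} (hf : 0 ≤ f) (hz : Confirms α c z) (hcf : Confirms α c f) :
    |z - f| ≤ α * f := by
  have card_pos : (0 : ℝ) < Fintype.card κ := by exact_mod_cast Fintype.card_pos
  rw [Confirms, abs_le] at hz hcf
  have upper : z * (1 - α / 3) ≤ f * (1 + α / 3) :=
    le_of_mul_le_mul_left (by linarith [hz.1, hcf.2]) card_pos
  have lower : f * (1 - α / 3) ≤ z * (1 + α / 3) :=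
    le_of_mul_le_mul_left (by linarith [hz.2, hcf.1]) card_pos
  have hfα : 0 ≤ f * α * (1 - α) := mul_nonneg (mul_nonneg hf hα.le) (sub_nonneg.2 hα1.le)
  rw [abs_le]
  constructor
  · refine le_of_mul_le_mul_right ?_ (show 0 < 1 + α / 3 by linarith)
    nlinarith [mul_nonneg hf hα.le]
  · refine le_of_mul_le_mul_right ?_ (show 0 < 1 - α / 3 by linarith)
    nlinarith

namespace FourwiseUncorrelated

variable {Ω ι κ : Type*} [Fintype Ω] [Nonempty Ω] [Fintype ι] [Fintype κ]
  [DecidableEq κ]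

lemma sum_sq_sum_sq_dotProduct_sub_le {R : Type*} [CommRing R] [LinearOrder R]
    [IsStrictOrderedRing R] {ε : Ω → ι → R} (hε : FourwiseUncorrelated ε) (v : ι → R) :
    ∑ k : κ → Ω, (∑ j, ((ε (k j) ⬝ᵥ v) ^ 2 - v ⬝ᵥ v)) ^ 2 ≤
      2 * Fintype.card κ * Fintype.card (κ → Ω) * (v ⬝ᵥ v) ^ 2 := by
  have card_pos : (0 : R) < Fintype.card Ω := by exact_mod_cast Fintype.card_pos
  refine le_of_mul_le_mul_left ?_ card_pos
  calc Fintype.card Ω * ∑ k : κ → Ω, (∑ j, ((ε (k j) ⬝ᵥ v) ^ 2 - v ⬝ᵥ v)) ^ 2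
      = Fintype.card κ * (Fintype.card (κ → Ω) * ∑ s, ((ε s ⬝ᵥ v) ^ 2 - v ⬝ᵥ v) ^ 2) :=
        card_mul_sum_sq_sum (hε.sum_sq_dotProduct_sub v)
    _ ≤ Fintype.card κ *
          (Fintype.card (κ → Ω) * (2 * Fintype.card Ω * (v ⬝ᵥ v) ^ 2)) := by
        gcongr
        exact hε.sum_sq_sq_dotProduct_sub_le v
    _ = Fintype.card Ω * (2 * Fintype.card κ * Fintype.card (κ → Ω) * (v ⬝ᵥ v) ^ 2) := by ring

open scoped Classical in
lemma card_not_confirms_le {ε : Ω → ι → ℤ} (hε : FourwiseUncorrelated ε) {α : ℝ} (hα : 0 < α)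
    (hκ : 288 / α ^ 2 ≤ Fintype.card κ) (v : ι → ℤ) :
    16 * Finset.card {k : κ → Ω | ¬ Confirms α (fun j => ε (k j) ⬝ᵥ v) (v ⬝ᵥ v : ℤ)} ≤
      Fintype.card (κ → Ω) := by
  obtain rfl | hv := eq_or_ne v 0
  · simp [Confirms]
  have hf : (0 : ℝ) < (v ⬝ᵥ v : ℤ) := by
    have : v ⬝ᵥ v ≠ 0 := fun h => hv (dotProduct_self_eq_zero.1 h)
    exact_mod_cast lt_of_le_of_ne (Finset.sum_nonneg fun a _ => mul_self_nonneg (v a)) this.symm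
  have hw : (0 : ℝ) < Fintype.card κ := lt_of_lt_of_le (by positivity) hκ
  have variance : ∑ k : κ → Ω, (∑ j, ((ε (k j) ⬝ᵥ v : ℤ) : ℝ) ^ 2 -
      Fintype.card κ * (v ⬝ᵥ v : ℤ)) ^ 2 ≤
      2 * Fintype.card κ * Fintype.card (κ → Ω) * ((v ⬝ᵥ v : ℤ) : ℝ) ^ 2 := by
    have := hε.sum_sq_sum_sq_dotProduct_sub_le (κ := κ) v
    simp only [Finset.sum_sub_distrib, Finset.sum_const, Finset.card_univ, nsmul_eq_mul] at this
    exact_mod_cast this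
  set f : ℝ := ((v ⬝ᵥ v : ℤ) : ℝ)
  set w : ℝ := (Fintype.card κ : ℝ) with hw_def
  have chebyshev := (card_lt_abs_mul_sq_le
    (fun k : κ → Ω => ∑ j, ((ε (k j) ⬝ᵥ v : ℤ) : ℝ) ^ 2 - w * f)
    (t := α / 3 * (w * f)) (by positivity)).trans variance
  simp only [Confirms, not_le, ← hw_def]
  set failures := Finset.card {k : κ → Ω | α / 3 * (w * f) <
    |∑ j, ((ε (k j) ⬝ᵥ v : ℤ) : ℝ) ^ 2 - w * f|}
  have few_failures : failures * (w * α ^ 2) ≤ 18 * Fintype.card (κ → Ω) := by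
    refine le_of_mul_le_mul_left ?_ (show 0 < w * f ^ 2 / 9 by positivity)
    linear_combination chebyshev
  have : failures * 288 ≤ failures * (w * α ^ 2) := by
    gcongr
    exact (div_le_iff₀ (by positivity)).1 hκ
  have : 16 * (failures : ℝ) ≤ Fintype.card (κ → Ω) := by linarith
  exact_mod_cast this

end FourwiseUncorrelated

/-! ### The sketch for the second moment -/

section Moment

variable {n : ℕ}

lemma freq_append (u : List (Update n)) (x : Update n) :
    freq (u ++ [x]) = freq u + Pi.single x.1 (x.2 : ℤ) := by
  ext a
  simp [freq, Pi.single_apply, eq_comm]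

lemma dotProduct_freq_append (v : Fin n → ℤ) (u : List (Update n)) (x : Update n) :
    v ⬝ᵥ freq (u ++ [x]) = v ⬝ᵥ freq u + v x.1 * x.2 := by
  rw [freq_append, dotProduct_add, dotProduct_single]

lemma abs_dotProduct_freq_le {v : Fin n → ℤ} {L : ℤ} (hv : ∀ a, |v a| ≤ L)
    (u : List (Update n)) : |v ⬝ᵥ freq u| ≤ L * u.length := by
  induction u using List.reverseRecOn with
  | nil => simp [dotProduct, freq]
  | append_singleton u x ih =>
    have abs_sign : |(x.2 : ℤ)| = 1 := Int.isUnit_iff_abs_eq.1 x.2.isUnit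
    calc |v ⬝ᵥ freq (u ++ [x])| ≤ |v ⬝ᵥ freq u| + |v x.1 * x.2| := by
          rw [dotProduct_freq_append]
          exact abs_add_le _ _
      _ ≤ L * u.length + L := by
          rw [abs_mul, abs_sign, mul_one]
          exact add_le_add ih (hv x.1)
      _ = L * (u ++ [x]).length := by
          rw [List.length_append, List.length_singleton]
          push_cast
          ring

lemma abs_freq_le (u : List (Update n)) (a : Fin n) : |freq u a| ≤ u.length := by
  have abs_single (b : Fin n) : |(Pi.single a 1 : Fin n → ℤ) b| ≤ 1 := by
    rw [Pi.single_apply]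
    split_ifs <;> simp
  simpa using abs_dotProduct_freq_le abs_single u

lemma F₂_eq_dotProduct (u : List (Update n)) : F₂ u = (freq u ⬝ᵥ freq u : ℤ) := by
  simp [F₂, dotProduct, sq]

/-- The second moment as a candidate; there is no wrap-around for streams of length at most `m`. -/
def momentCandidate (m : ℕ) (u : List (Update n)) : Fin (m ^ 2 + 1) :=
  Fin.ofNat _ (freq u ⬝ᵥ freq u).toNat

lemma coe_momentCandidate {m : ℕ} {u : List (Update n)} (hu : u.length ≤ m) :
    ((momentCandidate m u : ℕ) : ℝ) = F₂ u := by
  have hu' : (u.length : ℤ) ≤ m := by exact_mod_cast hu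
  have nonneg : 0 ≤ freq u ⬝ᵥ freq u := Finset.sum_nonneg fun a _ => mul_self_nonneg _
  have le_sq : freq u ⬝ᵥ freq u ≤ m ^ 2 :=
    calc freq u ⬝ᵥ freq u ≤ u.length * u.length :=
          (le_abs_self _).trans (abs_dotProduct_freq_le (abs_freq_le u) u)
      _ ≤ m ^ 2 := by
          rw [sq]
          gcongr
  have lt_card : (freq u ⬝ᵥ freq u).toNat < m ^ 2 + 1 := by
    zify
    rw [Int.toNat_of_nonneg nonneg]
    omega
  rw [F₂_eq_dotProduct, momentCandidate, Fin.val_ofNat, Nat.mod_eq_of_lt lt_card]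
  exact_mod_cast Int.toNat_of_nonneg nonneg

variable {Ω τ κ : Type*} [Fintype τ] [Fintype κ]

/-- The sketch for the second moment: the inner products of the frequency vector with random sign
vectors, kept modulo `M`. The counters are arranged in groups, indexed by `τ`, of counters indexed
by `κ`; a candidate gets the vote if it is confirmed by most of the groups. -/
def momentSketch (M m : ℕ) (α : ℝ) (ε : Ω → Fin n → ℤ) (τ κ : Type*) [Fintype τ] [Fintype κ] :
    VotingSketch (Update n) (τ → κ → Ω) (τ → κ → ZMod M) (Fin (m ^ 2 + 1)) where
  increment k x i j := (ε (k i j) x.1 * x.2 : ℤ)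
  vote c := {z | HoldsForMost fun i => Confirms α (fun j => (c i j).valMinAbs) (z : ℕ)}
  val z := (z : ℕ)

variable {M m : ℕ} {α : ℝ} {ε : Ω → Fin n → ℤ}

lemma counters_momentSketch (k : τ → κ → Ω) (u : List (Update n)) (i : τ) (j : κ) :
    (momentSketch M m α ε τ κ).counters k u i j = (ε (k i j) ⬝ᵥ freq u : ℤ) := by
  induction u using List.reverseRecOn with
  | nil => simp [VotingSketch.counters, dotProduct, freq]
  | append_singleton u x ih =>
    rw [VotingSketch.counters_append, Pi.add_apply, Pi.add_apply, ih, dotProduct_freq_append,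
      Int.cast_add]
    rfl

lemma mem_votes_momentSketch [Fintype Ω] (hε : FourwiseUncorrelated ε) (hM : 2 * m < M)
    {u : List (Update n)} (hu : u.length ≤ m) {k : τ → κ → Ω} {z : Fin (m ^ 2 + 1)} :
    z ∈ (momentSketch M m α ε τ κ).votes k u ↔
      HoldsForMost fun i => Confirms α (fun j => ε (k i j) ⬝ᵥ freq u) (z : ℕ) := by
  have : NeZero M := ⟨by omega⟩
  have valMinAbs_counters (i : τ) (j : κ) :
      ((momentSketch M m α ε τ κ).counters k u i j).valMinAbs = ε (k i j) ⬝ᵥ freq u := by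
    rw [counters_momentSketch, ZMod.valMinAbs_spec]
    have abs_sign (a : Fin n) : |ε (k i j) a| ≤ 1 :=
      (Int.isUnit_iff_abs_eq.1 (.of_mul_eq_one _ (hε.mul_self _ a))).le
    have := abs_le.1 (abs_dotProduct_freq_le abs_sign u)
    exact ⟨rfl, by omega, by omega⟩
  simp only [← valMinAbs_counters]
  rfl

lemma isGood_momentSketch [Fintype Ω] [Nonempty κ] (hε : FourwiseUncorrelated ε) (hα : 0 < α)
    (hα1 : α < 1) (hM : 2 * m < M) {u : List (Update n)} (hu : u.length ≤ m) {k : τ → κ → Ω}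
    (hk : HoldsForMost fun i => Confirms α (fun j => ε (k i j) ⬝ᵥ freq u) (F₂ u)) :
    (momentSketch M m α ε τ κ).IsGood F₂ α (momentCandidate m) u k := by
  refine ⟨?_, fun z hz => ?_⟩
  · rwa [mem_votes_momentSketch hε hM hu, coe_momentCandidate hu]
  · obtain ⟨i, hz, hF₂⟩ := ((mem_votes_momentSketch hε hM hu).1 hz).exists_and hk
    have nonneg : 0 ≤ F₂ u := Finset.sum_nonneg fun a _ => sq_nonneg _
    rw [abs_of_nonneg nonneg]
    exact hz.abs_sub_le hα hα1 nonneg hF₂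

theorem failsWithProbLE_momentSketch [Fintype Ω] [Nonempty Ω] [DecidableEq τ] [DecidableEq κ]
    (hε : FourwiseUncorrelated ε) (hα : 0 < α) (hα1 : α < 1) (hκ : 288 / α ^ 2 ≤ Fintype.card κ)
    (hM : 2 * m < M) : (momentSketch M m α ε τ κ).FailsWithProbLE F₂ α (momentCandidate m) m
      (2 ^ Fintype.card τ)⁻¹ := by
  classical
  intro u hu
  have : Nonempty κ := Fintype.card_pos_iff.1 <| by
    exact_mod_cast lt_of_lt_of_le (by positivity : 0 < 288 / α ^ 2) hκ
  let failures : Finset (τ → κ → Ω) :=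
    {k | ¬ HoldsForMost fun i => Confirms α (fun j => ε (k i j) ⬝ᵥ freq u) (F₂ u)}
  have failures_few : 2 ^ Fintype.card τ * failures.card ≤ Fintype.card (τ → κ → Ω) := by
    simp only [failures, F₂_eq_dotProduct]
    exact two_pow_mul_card_not_holdsForMost_le
      (P := fun s : κ → Ω => Confirms α (fun j => ε (s j) ⬝ᵥ freq u) _)
      (hε.card_not_confirms_le hα hκ (freq u))
  have bad_subset : {k | ¬ (momentSketch M m α ε τ κ).IsGood F₂ α (momentCandidate m) u k} ⊆
      (failures : Set (τ → κ → Ω)) := fun k hk => by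
    by_contra hk'
    exact hk (isGood_momentSketch hε hα hα1 hM hu (by simpa [failures] using hk'))
  refine (MeasureTheory.measure_mono bad_subset).trans ?_
  rw [PMF.toOuterMeasure_uniformOfFintype_apply, ← Set.toFinset_card, Finset.toFinset_coe,
    ENNReal.div_le_iff (by exact_mod_cast Fintype.card_ne_zero) (ENNReal.natCast_ne_top _),
    ← ENNReal.div_eq_inv_mul, ENNReal.le_div_iff_mul_le (by simp) (by simp), mul_comm]
  exact_mod_cast failures_few

end Moment

/-! ### Choice of the parameters -/

lemma one_add_inv_sq_pow_le {s N : ℕ} (hN : N ≤ s ^ 2) :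
    (1 + (s : ℝ≥0)⁻¹ ^ 2) ^ N ≤ 4 := by
  obtain rfl | hs := Nat.eq_zero_or_pos s
  · simp_all
  rw [← NNReal.coe_le_coe]
  push_cast
  calc (1 + ((s : ℝ)⁻¹) ^ 2) ^ N ≤ Real.exp ((s : ℝ)⁻¹ ^ 2) ^ (s ^ 2) :=
        (pow_le_pow_right₀ (le_add_of_nonneg_right (by positivity)) hN).trans <|
          pow_le_pow_left₀ (by positivity)
            (by linarith [Real.add_one_le_exp ((s : ℝ)⁻¹ ^ 2)]) _
    _ = Real.exp 1 := by
        rw [← Real.exp_nat_mul]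
        push_cast
        field_simp
    _ ≤ 4 := by linarith [Real.exp_one_lt_d9]

lemma two_pow_le_one_add_inv_pow {s : ℕ} (hs : 0 < s) (q : ℕ) :
    2 ^ q ≤ (1 + (s : ℝ≥0)⁻¹) ^ (q * s) := by
  rw [mul_comm, pow_mul]
  refine pow_le_pow_left₀ zero_le_two ?_ q
  calc (2 : ℝ≥0) = 1 + s * (s : ℝ≥0)⁻¹ := by
        rw [mul_inv_cancel₀ (by exact_mod_cast hs.ne'), one_add_one_eq_two]
    _ ≤ (1 + (s : ℝ≥0)⁻¹) ^ s := one_add_mul_le_pow_of_sq_nonneg (by simp) (by simp) (by simp) s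

lemma natCast_mul_inv_le_inv {a b c : ℕ} (h : a * c ≤ b) :
    (a * (b : ℝ≥0∞)⁻¹ : ℝ≥0∞) ≤ (c : ℝ≥0∞)⁻¹ := by
  rw [ENNReal.le_inv_iff_mul_le, mul_right_comm, ← div_eq_mul_inv]
  exact ENNReal.div_le_of_le_mul (by rw [one_mul]; exact_mod_cast h)

lemma failure_budget_le {l m c r t : ℕ} {x : ℝ≥0∞} (hl : 0 < l) (hm : m ≤ 2 ^ l)
    (hc : c ≤ 2 ^ (2 * l + 1)) (hr : r * 2 ^ (3 * l + 2) ≤ 2 ^ t) (hx : 2 ^ (6 * l) ≤ x) :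
    m * (r * (m * (2 * (2 ^ t)⁻¹)) + c * x⁻¹) ≤ (2 ^ l : ℝ≥0∞)⁻¹ := by
  have deviation_le : (m * (r * (m * (2 * (2 ^ t)⁻¹))) : ℝ≥0∞) ≤ (2 ^ (l + 1))⁻¹ := by
    have h : m * r * m * 2 * 2 ^ (l + 1) ≤ 2 ^ t :=
      calc m * r * m * 2 * 2 ^ (l + 1) ≤ 2 ^ l * r * 2 ^ l * 2 * 2 ^ (l + 1) := by gcongr
        _ = r * 2 ^ (3 * l + 2) := by ring
        _ ≤ 2 ^ t := hr
    simpa only [Nat.cast_mul, Nat.cast_pow, Nat.cast_ofNat, mul_assoc] using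
      natCast_mul_inv_le_inv h
  have potential_le : (m * (c * x⁻¹) : ℝ≥0∞) ≤ (2 ^ (l + 1))⁻¹ := by
    have h : m * c * 2 ^ (l + 1) ≤ 2 ^ (6 * l) :=
      calc m * c * 2 ^ (l + 1) ≤ 2 ^ l * 2 ^ (2 * l + 1) * 2 ^ (l + 1) := by gcongr
        _ = 2 ^ (4 * l + 2) := by ring
        _ ≤ 2 ^ (6 * l) := Nat.pow_le_pow_right two_pos (by omega)
    refine (mul_le_mul_right (mul_le_mul_right (ENNReal.inv_le_inv.2 hx) _) _).trans ?_
    simpa only [Nat.cast_mul, Nat.cast_pow, Nat.cast_ofNat, mul_assoc] using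
      natCast_mul_inv_le_inv h
  calc (m * (r * (m * (2 * (2 ^ t)⁻¹)) + c * x⁻¹) : ℝ≥0∞)
      ≤ (2 ^ (l + 1))⁻¹ + (2 ^ (l + 1))⁻¹ := by
        rw [mul_add]
        exact add_le_add deviation_le potential_le
    _ = (2 ^ l)⁻¹ := by
        rw [pow_succ, ENNReal.mul_inv (by simp) (by simp), ← mul_add, ENNReal.inv_two_add_inv_two,
          mul_one]

lemma mul_two_pow_le_two_pow {l m b t : ℕ} (hm : m ≤ 2 ^ l) (ht : 2 ^ (6 * l + 8) * b ≤ 2 ^ t) :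
    36 * l ^ 2 * m * b * 2 ^ (3 * l + 2) ≤ 2 ^ t :=
  calc 36 * l ^ 2 * m * b * 2 ^ (3 * l + 2)
      ≤ 2 ^ 6 * (2 ^ l) ^ 2 * 2 ^ l * b * 2 ^ (3 * l + 2) := by
        have : l ≤ 2 ^ l := Nat.lt_two_pow_self.le
        gcongr
        norm_num
    _ = 2 ^ (6 * l + 8) * b := by ring
    _ ≤ 2 ^ t := ht

/-- With `s = 6 l b · min η m` and `r = 6 l s` the number `min (η r b) m` of queries to one
generation is at most `s ^ 2`, so that the factor `(1 + s⁻¹ ^ 2) ^ min (η r b) m` is bounded, while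
`(1 + s⁻¹) ^ r` is at least `2 ^ (6 l)`. -/
theorem VotingSketch.FailsWithProbLE.exists_isRobust_of_le_two_pow {X : Type} {K G Z : Type*}
    [Fintype K] [Nonempty K] [AddCommGroup G] [Fintype G] [Fintype Z] [Nonempty Z]
    {Q : VotingSketch X K G Z} {g : List X → ℝ} {α : ℝ} {target : List X → Z} {m t : ℕ}
    (hQ : Q.FailsWithProbLE g α target m (2 ^ (2 * t))⁻¹) {η a b l : ℕ} {β : ℝ} (hη : 0 < η)
    (hm : 0 < m) (hb : 0 < b) (hl : 0 < l) (hK : Fintype.card K ≤ 2 ^ a)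
    (hG : Fintype.card G ≤ 2 ^ b) (hZ : Fintype.card Z ≤ 2 ^ (2 * l + 1)) (hml : m ≤ 2 ^ l)
    (hβ : (2 ^ l)⁻¹ ≤ β) (ht : 2 ^ (6 * l + 8) * b ≤ 2 ^ t) :
    ∃ alg : Algorithm X (4 * (36 * l ^ 2 * min η m * b) * (a + b)),
      ∀ T, alg.IsRobust g η m T α β := by
  set s := 6 * l * min η m * b with hs
  have hr : 36 * l ^ 2 * min η m * b = 6 * l * s := by rw [hs]; ring
  have : 0 < min η m := lt_min hη hm
  have hs_pos : 0 < s := by positivity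
  rw [hr]
  have queries_le : min (η * (6 * l * s * b)) m ≤ s ^ 2 := by
    have hs_sq : s ^ 2 = min η m * (6 * l * s * b) := by rw [hs]; ring
    rw [hs_sq]
    rcases le_total η m with h | h
    · rw [min_eq_left h]
      exact min_le_left _ _
    · rw [min_eq_right h]
      exact (min_le_right _ _).trans (Nat.le_mul_of_pos_right m (by positivity))
  refine hQ.exists_isRobust (θ := (s : ℝ≥0)⁻¹) (δ := 2 * (2 ^ t)⁻¹) hη (by positivity) hb
    ((by positivity : (0 : ℝ) ≤ (2 ^ l)⁻¹).trans hβ) hK hG ?_ ?_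
  · calc _ ≤ (4 : ℝ≥0∞) * (2 ^ (2 * t))⁻¹ :=
          mul_le_mul_left (by exact_mod_cast one_add_inv_sq_pow_le queries_le) _
      _ = (2 * (2 ^ t)⁻¹) ^ 2 := by
          rw [mul_pow, ← ENNReal.inv_pow, ← pow_mul, mul_comm t]
          norm_num
  · refine (failure_budget_le hl hml hZ
      (hr ▸ mul_two_pow_le_two_pow ((min_le_right η m).trans hml) ht)
      (by exact_mod_cast two_pow_le_one_add_inv_pow hs_pos (6 * l))).trans ?_
    rw [← ENNReal.ofReal_ofNat, ← ENNReal.ofReal_pow zero_le_two,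
      ← ENNReal.ofReal_inv_of_pos (by positivity)]
    exact ENNReal.ofReal_le_ofReal hβ

lemma ceil_div_sq_le {α : ℝ} (hα : 0 < α) (hα1 : α ≤ 1) :
    (⌈288 / α ^ 2⌉₊ : ℝ) ≤ 289 * α⁻¹ ^ 2 := by
  have one_le : 1 ≤ α⁻¹ ^ 2 := one_le_pow₀ ((one_le_inv₀ hα).2 hα1)
  calc (⌈288 / α ^ 2⌉₊ : ℝ) ≤ 288 / α ^ 2 + 1 := (Nat.ceil_lt_add_one (by positivity)).le
    _ = 288 * α⁻¹ ^ 2 + 1 := by rw [div_eq_mul_inv, inv_pow]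
    _ ≤ 289 * α⁻¹ ^ 2 := by linarith

lemma two_pow_mul_le_two_pow {l w : ℕ} (hl : 0 < l) (hw : w ≤ 2 ^ (2 * l + 9)) :
    2 ^ (6 * l + 8) * (70 * (l * (l + 2)) * w) ≤ 2 ^ (35 * l) :=
  calc 2 ^ (6 * l + 8) * (70 * (l * (l + 2)) * w)
      ≤ 2 ^ (6 * l + 8) * (2 ^ 7 * (2 ^ l * 2 ^ (l + 1)) * 2 ^ (2 * l + 9)) := by
        have : l ≤ 2 ^ l := Nat.lt_two_pow_self.le
        have : l + 2 ≤ 2 ^ (l + 1) := Nat.lt_two_pow_self (n := l + 1)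
        gcongr
        norm_num
    _ = 2 ^ (10 * l + 25) := by ring
    _ ≤ 2 ^ (35 * l) := Nat.pow_le_pow_right two_pos (by omega)

/-- The binary length `l` of the parameters determines `70 l` groups of `w` counters, each kept
modulo `2 ^ (l + 2)` and with a sign function coded by `2 l` bits. -/
lemma exists_isRobust_F₂_of_le_two_pow {η n m l w : ℕ} {α β : ℝ} (hη : 0 < η) (hm : 0 < m)
    (hα : 0 < α) (hα1 : α < 1) (hl : 0 < l) (hnl : n ≤ 2 ^ l) (hml : m ≤ 2 ^ l)
    (hβl : (2 ^ l)⁻¹ ≤ β) (hαw : 288 / α ^ 2 ≤ w) (hwl : w ≤ 2 ^ (2 * l + 9)) :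
    ∃ (S : ℕ) (alg : Algorithm (Update n) S), S ≤ 10584000 * l ^ 6 * η * w ^ 2 ∧
      ∀ T, alg.IsRobust F₂ η m T α β := by
  obtain ⟨Ω, _, ε, card_Ω, hε⟩ :=
    exists_fourwiseUncorrelated (ι := Fin n) hl.ne' (by rwa [Fintype.card_fin])
  have : Nonempty Ω := Fintype.card_pos_iff.1 (card_Ω ▸ by positivity)
  have hw : 0 < w := by exact_mod_cast lt_of_lt_of_le (by positivity : 0 < 288 / α ^ 2) hαw
  have l_add_two_le : l + 2 ≤ 3 * l := by omega
  have hK : Fintype.card (Fin (2 * (35 * l)) → Fin w → Ω) ≤ 2 ^ (140 * l ^ 2 * w) := by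
    simp only [Fintype.card_fun, Fintype.card_fin, card_Ω, show 4 = 2 ^ 2 from rfl, ← pow_mul]
    exact (congrArg (2 ^ ·) (by ring)).le
  have hG : Fintype.card (Fin (2 * (35 * l)) → Fin w → ZMod (2 ^ (l + 2))) ≤
      2 ^ (70 * (l * (l + 2)) * w) := by
    simp only [Fintype.card_fun, Fintype.card_fin, ZMod.card, ← pow_mul]
    exact (congrArg (2 ^ ·) (by ring)).le
  have hZ : Fintype.card (Fin (m ^ 2 + 1)) ≤ 2 ^ (2 * l + 1) := by
    rw [Fintype.card_fin, pow_succ 2 (2 * l), mul_two, mul_comm 2 l, pow_mul]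
    exact add_le_add (Nat.pow_le_pow_left hml 2) (Nat.one_le_pow _ _ (by positivity))
  have hM : 2 * m < 2 ^ (l + 2) := by
    rw [pow_add]
    linarith [Nat.two_pow_pos l]
  have hQ := failsWithProbLE_momentSketch (τ := Fin (2 * (35 * l))) (κ := Fin w) hε hα hα1
    (by rwa [Fintype.card_fin]) hM
  rw [Fintype.card_fin] at hQ
  obtain ⟨alg, halg⟩ := hQ.exists_isRobust_of_le_two_pow hη hm (by positivity) hl hK hG hZ hml hβl
    (two_pow_mul_le_two_pow hl hwl)
  refine ⟨_, alg, ?_, halg⟩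
  calc 4 * (36 * l ^ 2 * min η m * (70 * (l * (l + 2)) * w)) *
        (140 * l ^ 2 * w + 70 * (l * (l + 2)) * w)
      ≤ 4 * (36 * l ^ 2 * η * (70 * (l * (3 * l)) * w)) *
        (140 * l ^ 2 * w + 70 * (l * (3 * l)) * w) := by
        gcongr
        exact min_le_left _ _
    _ = 10584000 * l ^ 6 * η * w ^ 2 := by ring

lemma exists_le_two_pow_le_log {y : ℝ} (hy : 3 ≤ y) :
    ∃ l : ℕ, 0 < l ∧ y ≤ 2 ^ l ∧ l ≤ 3 * Real.log y := by
  have one_le_log : 1 ≤ Real.log y :=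
    (Real.le_log_iff_exp_le (by linarith)).2 (by linarith [Real.exp_one_lt_d9])
  refine ⟨⌈2 * Real.log y⌉₊, Nat.ceil_pos.2 (by linarith), ?_, ?_⟩
  · rw [← Real.log_le_log_iff (by linarith) (by positivity), Real.log_pow]
    nlinarith [Nat.le_ceil (2 * Real.log y), Real.log_two_gt_d9]
  · linarith [(Nat.ceil_lt_add_one (a := 2 * Real.log y) (by linarith)).le]

lemma le_two_add_mul_div {n m : ℕ} {α β : ℝ} (hn : 0 < n) (hm : 0 < m) (hα : 0 < α) (hα1 : α ≤ 1)
    (hβ : 0 < β) (hβ1 : β ≤ 1) :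
    3 ≤ 2 + n * m / (α * β) ∧ n ≤ 2 + n * m / (α * β) ∧ m ≤ 2 + n * m / (α * β) ∧
      α⁻¹ ≤ 2 + n * m / (α * β) ∧ β⁻¹ ≤ 2 + n * m / (α * β) := by
  have hn1 : (1 : ℝ) ≤ n := by exact_mod_cast hn
  have hm1 : (1 : ℝ) ≤ m := by exact_mod_cast hm
  have hα' : 1 ≤ α⁻¹ := (one_le_inv₀ hα).2 hα1
  have hβ' : 1 ≤ β⁻¹ := (one_le_inv₀ hβ).2 hβ1
  have hnm : (1 : ℝ) ≤ n * m := one_le_mul_of_one_le_of_one_le hn1 hm1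
  have hαβ : 1 ≤ α⁻¹ * β⁻¹ := one_le_mul_of_one_le_of_one_le hα' hβ'
  rw [div_eq_mul_inv, mul_inv]
  have hle : (n * m : ℝ) ≤ n * m * (α⁻¹ * β⁻¹) := le_mul_of_one_le_right (by positivity) hαβ
  have hle' : α⁻¹ * β⁻¹ ≤ n * m * (α⁻¹ * β⁻¹) := le_mul_of_one_le_left (by positivity) hnm
  refine ⟨?_, ?_, ?_, ?_, ?_⟩ <;> nlinarith

theorem exists_isRobust_F₂ {η n m : ℕ} {α β : ℝ} (hη : 0 < η) (hn : 0 < n) (hm : 0 < m)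
    (hα : 0 < α) (hα1 : α < 1) (hβ : 0 < β) (hβ1 : β ≤ 1) :
    ∃ (S : ℕ) (alg : Algorithm (Update n) S),
      S ≤ 10584000 * 729 * 289 ^ 2 * (η / α ^ 4) * Real.log (2 + n * m / (α * β)) ^ 6 ∧
        ∀ T, alg.IsRobust F₂ η m T α β := by
  obtain ⟨hy, hny, hmy, hαy, hβy⟩ := le_two_add_mul_div hn hm hα hα1.le hβ hβ1
  set y := 2 + n * m / (α * β)
  obtain ⟨l, hl, hyl, hlog⟩ := exists_le_two_pow_le_log hy
  have ceil_le : (⌈288 / α ^ 2⌉₊ : ℝ) ≤ 289 * α⁻¹ ^ 2 := ceil_div_sq_le hα hα1.le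
  have ceil_le_two_pow : ⌈288 / α ^ 2⌉₊ ≤ 2 ^ (2 * l + 9) := by
    have : (⌈288 / α ^ 2⌉₊ : ℝ) ≤ 2 ^ (2 * l + 9) :=
      calc (⌈288 / α ^ 2⌉₊ : ℝ) ≤ 289 * α⁻¹ ^ 2 := ceil_le
        _ ≤ 2 ^ 9 * (2 ^ l) ^ 2 := by
          gcongr
          · norm_num
          · exact hαy.trans hyl
        _ = 2 ^ (2 * l + 9) := by ring
    exact_mod_cast this
  obtain ⟨S, alg, hS, halg⟩ := exists_isRobust_F₂_of_le_two_pow hη hm hα hα1 hl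
    (by exact_mod_cast hny.trans hyl) (by exact_mod_cast hmy.trans hyl)
    (inv_le_of_inv_le₀ hβ (hβy.trans hyl)) (Nat.le_ceil _) ceil_le_two_pow
  refine ⟨S, alg, ?_, halg⟩
  calc (S : ℝ) ≤ 10584000 * l ^ 6 * η * (⌈288 / α ^ 2⌉₊ : ℝ) ^ 2 := by exact_mod_cast hS
    _ ≤ 10584000 * (3 * Real.log y) ^ 6 * η * (289 * α⁻¹ ^ 2) ^ 2 := by gcongr
    _ = 10584000 * 729 * 289 ^ 2 * (η / α ^ 4) * Real.log y ^ 6 := by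
        rw [div_eq_mul_inv, ← inv_pow]
        ring

/-! ### Degenerate parameters -/

lemma isRobust_of_forall_mem_support {X : Type} {S : ℕ} {alg : Algorithm X S} {g : List X → ℝ}
    {η m : ℕ} {α β : ℝ} (hβ : 0 ≤ β)
    (h : ∀ adv, ∀ c ∈ (play η alg adv m).support, History.Accurate g α c.2) (T : ℕ) :
    alg.IsRobust g η m T α β :=
  isRobust_of_expect_le hβ (fun adv => expect_le_of_forall_le fun c hc => by
    rw [Set.indicator_of_notMem (not_not.2 (h adv c hc))]
    exact zero_le) T

lemma isRobust_of_one_le {X : Type} {S : ℕ} (alg : Algorithm X S) (g : List X → ℝ) (η m T : ℕ)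
    (α : ℝ) {β : ℝ} (hβ : 1 ≤ β) : alg.IsRobust g η m T α β := fun adv _ => by
  rw [ENNReal.ofReal_of_nonpos (by linarith)]
  exact zero_le

lemma isRobust_of_isEmpty {X : Type} [IsEmpty X] {S : ℕ} (alg : Algorithm X S) (g : List X → ℝ)
    (η m T : ℕ) (α β : ℝ) : alg.IsRobust g η m T α β := fun adv _ =>
  isEmptyElim (adv []).support_nonempty.choose.1

lemma isRobust_zero {X : Type} {S : ℕ} (alg : Algorithm X S) (g : List X → ℝ) (η T : ℕ)
    (α : ℝ) {β : ℝ} (hβ : 0 ≤ β) : alg.IsRobust g η 0 T α β := by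
  refine isRobust_of_forall_mem_support hβ (fun adv c hc => ?_) T
  simp only [play, PMF.mem_support_bind_iff, PMF.mem_support_pure_iff] at hc
  obtain ⟨s, -, rfl⟩ := hc
  exact History.accurate_nil g α

/-- The algorithm without memory that always responds `0`. -/
def zeroAlgorithm (X : Type) : Algorithm X 0 where
  init := PMF.pure Fin.elim0
  update s _ := PMF.pure s
  respond s := PMF.pure (s, 0)
  predicate _ _ := false
  receive s _ := PMF.pure s

lemma accurate_of_mem_support_play_zeroAlgorithm {X : Type} {g : List X → ℝ} {α : ℝ} (hα : 1 ≤ α)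
    (η : ℕ) (adv : Adversary X) {m : ℕ} {c : (Fin 0 → Bool) × History X}
    (hc : c ∈ (play η (zeroAlgorithm X) adv m).support) : History.Accurate g α c.2 := by
  induction m generalizing c with
  | zero =>
    simp only [play, zeroAlgorithm, PMF.pure_bind, PMF.mem_support_pure_iff] at hc
    rw [hc]
    exact History.accurate_nil g α
  | succ m ih =>
    simp only [play, playRound, zeroAlgorithm, PMF.pure_bind, PMF.mem_support_bind_iff] at hc
    obtain ⟨c', hc', move, -, hc⟩ := hc
    have zero_accurate (u : List X) : |0 - g u| ≤ α * |g u| := by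
      rw [zero_sub, abs_neg]
      exact le_mul_of_one_le_left (abs_nonneg _) hα
    split_ifs at hc <;> rw [PMF.mem_support_pure_iff] at hc <;> rw [hc]
    · exact History.accurate_append_some_iff.2 ⟨ih hc', zero_accurate _⟩
    · exact History.accurate_append_some_iff.2 ⟨ih hc', zero_accurate _⟩
    · exact History.accurate_append_none_iff.2 (ih hc')

lemma isRobust_zeroAlgorithm_F₂ {n η m : ℕ} {α β : ℝ} (hβ : 0 ≤ β)
    (h : 1 ≤ α ∨ 1 ≤ β ∨ n = 0 ∨ m = 0) (T : ℕ) :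
    (zeroAlgorithm (Update n)).IsRobust F₂ η m T α β := by
  rcases h with hα | hβ1 | rfl | rfl
  · exact isRobust_of_forall_mem_support hβ
      (fun adv c => accurate_of_mem_support_play_zeroAlgorithm hα η adv) T
  · exact isRobust_of_one_le _ _ η m T α hβ1
  · exact isRobust_of_isEmpty _ _ η m T α β
  · exact isRobust_zero _ _ η T α hβ

end ASA

end

theorem mainTheorem5 :
    ∃ (C : ℝ) (c : ℕ), 0 < C ∧
      ∀ (η n m : ℕ) (α β : ℝ), 1 ≤ η → 0 < α → 0 < β →
        ∃ (S : ℕ) (alg : ASA.Algorithm (ASA.Update n) S),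
          (S : ℝ) ≤ C * ((η : ℝ) / α ^ 4) * Real.log (2 + (n : ℝ) * (m : ℝ) / (α * β)) ^ c ∧
          ∀ T : ℕ, alg.IsRobust ASA.F₂ η m T α β := by
  refine ⟨10584000 * 729 * 289 ^ 2, 6, by norm_num, fun η n m α β hη hα hβ => ?_⟩
  by_cases degenerate : 1 ≤ α ∨ 1 ≤ β ∨ n = 0 ∨ m = 0
  · have : 0 ≤ Real.log (2 + n * m / (α * β)) :=
      Real.log_nonneg (le_add_of_le_of_nonneg one_le_two (by positivity))
    refine ⟨0, ASA.zeroAlgorithm (ASA.Update n), ?_, ASA.isRobust_zeroAlgorithm_F₂ hβ.le degenerate⟩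
    rw [Nat.cast_zero]
    positivity
  · push Not at degenerate
    obtain ⟨hα1, hβ1, hn, hm⟩ := degenerate
    exact ASA.exists_isRobust_F₂ hη (Nat.pos_of_ne_zero hn) (Nat.pos_of_ne_zero hm) hα hα1 hβ hβ1.le
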